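/- **Model.** Let $\mu$ be a probability law on $\mathbb R$ symmetric about $0$, let $\theta_1>1/\mathbb E[\operatorname{sech}^2(h)]$ for $h\sim\mu$ (low temperature). For $S\subset[n]$ with $|S|=k$, one sample $\sigma\in\{-1,1\}^n$ under the alternative $\mathbb P_S$ is drawn as follows: $h_1,\dots,h_n$ are i.i.d. with law $\mu$ and, given $h$, $\sigma$ has probability proportional to $\exp\big(\frac{\theta_1}{2k}(\sum_{i\in S}\sigma_i)^2+\sum_{i=1}^n h_i\sigma_i\big)$. Under the null $\mathbb P_0$ the quadratic term is absent. We observe $m$ i.i.d. samples $\sigma^{(1)},\dots,\sigma^{(m)}$ (each with its own field). Put $m_S=\frac1k\sum_{i\in S}\sigma_i$, $m_{S^c}=\frac1{n-k}\sum_{i\notin S}\sigma_i$ (with $\frac{n-k}{k}m_{S^c}$ read as $0$ if $k=n$), $$\phi_3=\max_{|S'|=k}\frac1m\sum_{j=1}^m\Big|\frac1k\sum_{i\in S'}\sigma^{(j)}_i\Big|,\qquad T=\Big|\frac1k\sum_{i=1}^n\sigma_i\Big|=\Big|m_S+\frac{n-k}{k}m_{S^c}\Big|,\qquad \phi_4=\frac1m\sum_{j=1}^m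 T(\sigma^{(j)}).$$ The test based on $\phi$ with threshold $\tau$ rejects the null iff $\phi\ge\tau$; its error at $S$ is $\mathbb P_0(\phi\ge\tau)+\mathbb P_S(\phi<\tau)$. Let $F(x,v)=\sqrt{\tfrac{2v}{\pi}}\,e^{-x^2/(2v)}+x\big(1-2\Phi(-x/\sqrt v)\big)$ be the mean of the folded normal law $\mathcal{FN}(x,v)$ of $|N(x,v)|$, where $\Phi$ is the standard normal distribution function. **Theorem.** The equation $y=\mathbb E[\tanh(\theta_1y+h)]$ has a smallest positive solution $x$, and the following hold. 1. *(Scan test, $m\asymp\log n$.)* For every $\tau\in(0,x)$ there is $C>0$ such that for every $\delta>0$ there is $K$ such that, whenever $k\ge K$ and $m\ge C\log n$, the test based on $\phi_3$ with threshold $\tau$ has error at most $\delta$ at every $S\subset[n]$ with $|S|=k$. 2. *(Global test, $k\asymp\sqrt n$, $m\asymp1$.)* For all $0<a\le b$, $t\in(0,1)$ and $\delta>0$ there are $M,N$ such that, whenever $n\ge N$, $a\sqrt n\le k\le b\sqrt n$ and $m\ge M$, the test based on $\phi_4$ with threshold $(1-t)F(0,\frac n{k^2})+tF(x,\frac n{k^2})$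 has error at most $\delta$ at every $S$ with $|S|=k$. 3. *(Folded normal limits, $k\asymp\sqrt n$.)* Along every sequence with $n\to\infty$ and $n/k^2\to v\in(0,\infty)$: under the null, $T\to\mathcal{FN}(0,v)$ in distribution and $\mathbb E_0[T]\to F(0,v)=\sqrt{2v/\pi}$; and, if $x$ is the only positive solution, then under $\mathbb P_S$ with any $S=S_n$, $|S_n|=k$, $T\to\mathcal{FN}(x,v)$ in distribution and $\mathbb E_S[T]\to F(x,v)$. 4. *(Global test, $k=\omega(\sqrt n)$, one sample.)* For every $\tau\in(0,x)$ and $\delta>0$ there is $A$ such that, whenever $k\ge 1$, $k\ge A\sqrt n$ and $m\ge1$ (in particular for $m=1$), the test based on $\phi_4$ with threshold $\tau$ has error at most $\delta$ at every $S\subset[n]$ with $|S|=k$. Moreover, when $k/\sqrt n\to\infty$, $T\to0$ in probability under the null, and, if $x$ is the only positive solution, $T\to x$ in probability under $\mathbb P_S$, uniformly over $S$ with $|S|=k$: for all $\varepsilon,\delta>0$ there is $A$ such that $k\ge1$, $k\ge A\sqrt n$ imply $\mathbb P_0(T\ge\varepsilon)\le\delta$, respectively $\mathbb P_S(|T-x|\ge\varepsilon)\le\delta$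 for all $S$ with $|S|=k$. -/

import Mathlib

open MeasureTheory ProbabilityTheory Filter
open scoped NNReal Topology

namespace PlantedRFCW

noncomputable section

/-- Spin configurations on `n` sites (`true` stands for `+1`, `false` for `-1`). -/
abbrev Config (n : ℕ) : Type := Fin n → Bool

/-- The value `±1` of a spin. -/
def spin (b : Bool) : ℝ := if b then 1 else -1

/-- Quenched Gibbs probability of `σ` given the field `h`, for the Hamiltonian
`J σ + ∑ i, h i * σ i`. -/
def gibbsProb {n : ℕ} (J : Config n → ℝ) (h : Fin n → ℝ) (σ : Config n) : ℝ :=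
  Real.exp (J σ + ∑ i, h i * spin (σ i)) / ∑ τ : Config n, Real.exp (J τ + ∑ i, h i * spin (τ i))

/-- Probability of `σ` when the field has i.i.d. coordinates of law `μ` and `σ` is drawn from the
Gibbs measure given the field. -/
def siteProb {n : ℕ} (μ : Measure ℝ) (J : Config n → ℝ) (σ : Config n) : ℝ :=
  ∫ h, gibbsProb J h σ ∂(Measure.pi fun _ : Fin n => μ)

/-- The law of one sample `σ`, as a measure on configurations. -/
def fieldLaw {n : ℕ} (μ : Measure ℝ) (J : Config n → ℝ) : Measure (Config n) :=
  ∑ σ : Config n, ENNReal.ofReal (siteProb μ J σ) • Measure.dirac σ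

/-- Curie-Weiss interaction on the clique `S`: `θ / (2 |S|) * (∑ i ∈ S, σ i) ^ 2`. -/
def cliqueInteraction {n : ℕ} (θ : ℝ) (S : Finset (Fin n)) (σ : Config n) : ℝ :=
  θ / (2 * (S.card : ℝ)) * (∑ i ∈ S, spin (σ i)) ^ 2

/-- Law of one sample under the null hypothesis: no interaction. -/
def nullLaw (n : ℕ) (μ : Measure ℝ) : Measure (Config n) := fieldLaw μ (fun _ => 0)

/-- Law of one sample under the alternative with hidden clique `S`. -/
def cliqueLaw {n : ℕ} (μ : Measure ℝ) (θ : ℝ) (S : Finset (Fin n)) : Measure (Config n) :=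
  fieldLaw μ (cliqueInteraction θ S)

/-- Law of `m` i.i.d. samples under the null (each sample has its own independent field). -/
def nullSampleLaw (n m : ℕ) (μ : Measure ℝ) : Measure (Fin m → Config n) :=
  Measure.pi fun _ => nullLaw n μ

/-- Law of `m` i.i.d. samples under the alternative with hidden clique `S`
(each sample has its own independent field). -/
def cliqueSampleLaw {n : ℕ} (m : ℕ) (μ : Measure ℝ) (θ : ℝ) (S : Finset (Fin n)) :
    Measure (Fin m → Config n) :=
  Measure.pi fun _ => cliqueLaw μ θ S

/-- Average magnetization `m_S` of `σ` on `S`. -/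
def magnetization {n : ℕ} (S : Finset (Fin n)) (σ : Config n) : ℝ :=
  (∑ i ∈ S, spin (σ i)) / (S.card : ℝ)

/-- `φ_S = (1/m) ∑ j, |(1/k) ∑ i ∈ S, σ i^(j)|`, where `k = |S|`. -/
def localStat {n m : ℕ} (S : Finset (Fin n)) (X : Fin m → Config n) : ℝ :=
  (∑ j, |magnetization S (X j)|) / (m : ℝ)

/-- The scan statistic: the maximum of `φ_S` over all `S` of size `k`. -/
def scanStat {n m : ℕ} (k : ℕ) (X : Fin m → Config n) : ℝ :=
  ⨆ S : {S : Finset (Fin n) // S.card = k}, localStat S.1 X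

/-- The one-sample global statistic `|(1/k) ∑ i, σ i|`. It does not involve the clique; it equals
`|m_S + ((n - k) / k) * m_{Sᶜ}|` for every `S` of size `k ≥ 1`
(see `globalTerm_eq`). -/
def globalTerm {n : ℕ} (k : ℕ) (σ : Config n) : ℝ := |(∑ i, spin (σ i)) / (k : ℝ)|

/-- The global statistic: the average of the one-sample statistic over the `m` samples. -/
def globalStat {n m : ℕ} (k : ℕ) (X : Fin m → Config n) : ℝ :=
  (∑ j, globalTerm k (X j)) / (m : ℝ)

/-- Sum of the Type I error and the Type II error, when the hidden clique is `S`, of the test that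
rejects the null hypothesis if and only if `T ≥ τ`. -/
def totalError {n m : ℕ} (μ : Measure ℝ) (θ : ℝ) (T : (Fin m → Config n) → ℝ) (τ : ℝ)
    (S : Finset (Fin n)) : ℝ :=
  (nullSampleLaw n m μ).real {X | τ ≤ T X} + (cliqueSampleLaw m μ θ S).real {X | T X < τ}

/-- `E[sech² h]`. -/
def meanSechSq (μ : Measure ℝ) : ℝ := ∫ h, (1 / Real.cosh h) ^ 2 ∂μ

/-- The positive solutions `y` of `y = E[tanh (θ y + h)]`. -/
def positiveSolutions (μ : Measure ℝ) (θ : ℝ) : Set ℝ :=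
  {y | 0 < y ∧ y = ∫ h, Real.tanh (θ * y + h) ∂μ}

/-- The closed form of the mean of the folded normal law `|N(x, v)|`, for `v > 0`. -/
def foldedMean (x v : ℝ) : ℝ :=
  √v * √(2 / Real.pi) * Real.exp (-(x ^ 2) / (2 * v))
    + x * (1 - 2 * cdf (gaussianReal 0 1) (-x / √v))

theorem globalTerm_eq {n : ℕ} (S : Finset (Fin n)) (hS : 0 < S.card) (σ : Config n) :
    globalTerm S.card σ = |magnetization S σ
      + ((n : ℝ) - S.card) / S.card * magnetization Sᶜ σ| := by
  have hk : (S.card : ℝ) ≠ 0 := by positivity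
  have hc : ((Sᶜ.card : ℕ) : ℝ) = (n : ℝ) - S.card := by
    rw [Finset.card_compl, Fintype.card_fin, Nat.cast_sub]
    simpa using S.card_le_univ
  unfold globalTerm magnetization
  rw [← Finset.sum_add_sum_compl S, ← hc]
  by_cases h0 : ((Sᶜ.card : ℕ) : ℝ) = 0
  · have : Sᶜ = ∅ := by
      rw [← Finset.card_eq_zero]; exact_mod_cast h0
    simp [this]
  · congr 1
    field_simp

theorem gibbsProb_nonneg {n : ℕ} (J : Config n → ℝ) (h : Fin n → ℝ) (σ : Config n) :
    0 ≤ gibbsProb J h σ := by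
  unfold gibbsProb; positivity

theorem sum_gibbsProb {n : ℕ} (J : Config n → ℝ) (h : Fin n → ℝ) :
    ∑ σ, gibbsProb J h σ = 1 := by
  unfold gibbsProb
  rw [← Finset.sum_div]
  apply div_self
  have : 0 < ∑ τ : Config n, Real.exp (J τ + ∑ i, h i * spin (τ i)) :=
    Finset.sum_pos (fun _ _ => Real.exp_pos _) Finset.univ_nonempty
  exact this.ne'

theorem integrable_gibbsProb {n : ℕ} (μ : Measure ℝ) [IsProbabilityMeasure μ] (J : Config n → ℝ)
    (σ : Config n) :
    Integrable (fun h => gibbsProb J h σ) (Measure.pi fun _ : Fin n => μ) := by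
  refine Integrable.of_bound (C := 1) ?_ ?_
  · apply Measurable.aestronglyMeasurable
    unfold gibbsProb
    fun_prop
  · refine Eventually.of_forall fun h => ?_
    rw [Real.norm_of_nonneg (gibbsProb_nonneg J h σ), ← sum_gibbsProb J h]
    exact Finset.single_le_sum (fun τ _ => gibbsProb_nonneg J h τ) (Finset.mem_univ σ)

theorem sum_siteProb {n : ℕ} (μ : Measure ℝ) [IsProbabilityMeasure μ] (J : Config n → ℝ) :
    ∑ σ, siteProb μ J σ = 1 := by
  unfold siteProb
  rw [← integral_finsetSum _ (fun σ _ => integrable_gibbsProb μ J σ)]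
  simp [sum_gibbsProb]

instance fieldLaw.instIsProbabilityMeasure {n : ℕ} (μ : Measure ℝ) [IsProbabilityMeasure μ]
    (J : Config n → ℝ) : IsProbabilityMeasure (fieldLaw μ J) := by
  constructor
  have h0 : ∀ σ ∈ (Finset.univ : Finset (Config n)), 0 ≤ siteProb μ J σ := fun σ _ =>
    integral_nonneg fun h => gibbsProb_nonneg J h σ
  unfold fieldLaw
  simp only [Measure.coe_finsetSum, Finset.sum_apply, Measure.smul_apply, measure_univ,
    smul_eq_mul, mul_one]
  rw [← ENNReal.ofReal_sum_of_nonneg h0, sum_siteProb, ENNReal.ofReal_one]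

instance nullLaw.instIsProbabilityMeasure (n : ℕ) (μ : Measure ℝ) [IsProbabilityMeasure μ] :
    IsProbabilityMeasure (nullLaw n μ) := by
  unfold nullLaw; infer_instance

instance cliqueLaw.instIsProbabilityMeasure {n : ℕ} (μ : Measure ℝ) [IsProbabilityMeasure μ]
    (θ : ℝ) (S : Finset (Fin n)) : IsProbabilityMeasure (cliqueLaw μ θ S) := by
  unfold cliqueLaw; infer_instance

end

end PlantedRFCW

open PlantedRFCW

namespace PlantedRFCW

/-! ### Spin configurations and the law of one sample -/

/-! Two symmetries and one large deviation bound carry the whole argument.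

Gauge symmetry: multiplying both the fields and the spins by signs `ε i` preserves the field term,
and it preserves the law of the fields because `μ` is symmetric. Averaged over the field, the null
law is therefore uniform on configurations (`siteProb_zero`). Under the alternative, signs can be
changed freely off the clique, so the spins there are uniform and independent of those in the clique
(`integral_cliqueLaw_resample`). The one-sample global statistic is thus the absolute value of `m_S`
plus an independent random-walk term of size at most about `√n / k`.

Magnetization on the clique: the derivative of `freeEnergy` is `θ * (y - meanTanh μ θ y)`. Low
temperature means that `meanTanh` has slope greater than one at zero, so the free energy decreases
strictly from `0` to the smallest positive solution `x`. If `x` is the only solution, it increases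
afterwards. Completing the square bounds the quenched probability of `m_S = y` by the exponential of
a sum of i.i.d. bounded terms with mean `freeEnergy x - freeEnergy y`
(`sum_gibbsProb_magnetization_le`). A Chernoff bound over the field, followed by a union over the `k
+ 1` values of `m_S`, makes `|m_S| ≤ τ` exponentially unlikely for `τ < x`
(`cliqueLaw_magnetization_mem_le`). With uniqueness, `|m_S|` concentrates at `x`.

The scan test follows from a Chernoff and union bound under the null and from this concentration on
the true clique. For `k` much larger than `√n` the random-walk term vanishes, and Markov's
inequality is enough for any number of samples.

When `k` is of order `√n`, means must be compared. The identity `|a| = c⁻¹ ∫ (1 - cos (t a)) / t²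
dt` turns absolute moments into characteristic functions, giving a Gaussian approximation of `E|y +
noise|` uniform in `y` (`abs_integral_abs_add_sub_le`, `tendsto_absMomentDist`). The Gaussian means
for `0` and `x` differ by a uniform amount (`exists_meanAbs_gap`), so Chebyshev's inequality
separates the hypotheses. The distributional limits come from Lévy's continuity theorem, after `m_S`
is replaced by `|m_S|` using the symmetry of the noise. -/

theorem spin_sq (b : Bool) : spin b ^ 2 = 1 := by cases b <;> simp [spin]

theorem abs_spin (b : Bool) : |spin b| = 1 := by cases b <;> simp [spin]

theorem spin_beq (a b : Bool) : spin (a == b) = spin a * spin b := by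
  cases a <;> cases b <;> simp [spin]

theorem spin_mul_self (a : Bool) : spin a * spin a = 1 := by cases a <;> simp [spin]

/-- Sums of products over spin configurations factorize. -/
theorem sum_prod_config {n : ℕ} {R : Type*} [CommSemiring R] (f : Fin n → Bool → R) :
    ∑ σ : Config n, ∏ i, f i (σ i) = ∏ i, (f i true + f i false) := by
  have := Finset.prod_univ_sum (fun _ : Fin n => (Finset.univ : Finset Bool)) f
  rw [Fintype.piFinset_univ] at this
  rw [← this]
  simp

/-- Coordinatewise multiplication of the spin configuration `σ` by `ε`. -/
def twist {n : ℕ} (ε σ : Config n) : Config n := fun i => ε i == σ i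

theorem twist_twist {n : ℕ} (ε σ : Config n) : twist ε (twist ε σ) = σ := by
  funext i; simp only [twist]; cases ε i <;> cases σ i <;> rfl

theorem twist_comm {n : ℕ} (ε σ : Config n) : twist ε σ = twist σ ε := by
  funext i; simp only [twist]; cases ε i <;> cases σ i <;> rfl

theorem sum_twist {n : ℕ} {M : Type*} [AddCommMonoid M] (ε : Config n) (f : Config n → M) :
    ∑ σ, f (twist ε σ) = ∑ σ, f σ :=
  Fintype.sum_equiv (Function.Involutive.toPerm (twist ε) (twist_twist ε)) _ _ fun _ => rfl

theorem spin_twist {n : ℕ} (ε σ : Config n) (i : Fin n) :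
    spin (twist ε σ i) = spin (ε i) * spin (σ i) := spin_beq _ _

/-- Gauge symmetry: the signs cancel in each product of field and spin, and the partition function
is unchanged because twisting permutes the configurations. -/
theorem gibbsProb_twist {n : ℕ} {J : Config n → ℝ} {ε : Config n}
    (hJ : ∀ σ, J (twist ε σ) = J σ) (h : Fin n → ℝ) (σ : Config n) :
    gibbsProb J (fun i => spin (ε i) * h i) (twist ε σ) = gibbsProb J h σ := by
  have key : ∀ τ : Config n, J (twist ε τ) + ∑ i, spin (ε i) * h i * spin (twist ε τ i)
      = J τ + ∑ i, h i * spin (τ i) := fun τ => by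
    rw [hJ]
    congr 1
    refine Finset.sum_congr rfl fun i _ => ?_
    rw [spin_twist]
    linear_combination (h i * spin (τ i)) * spin_mul_self (ε i)
  unfold gibbsProb
  rw [← sum_twist ε, key]
  simp_rw [key]

theorem measurable_gibbsProb {n : ℕ} (J : Config n → ℝ) (σ : Config n) :
    Measurable fun h => gibbsProb J h σ := by
  unfold gibbsProb; fun_prop

theorem siteProb_twist {n : ℕ} (μ : Measure ℝ) [IsProbabilityMeasure μ]
    (hsymm : μ.map (fun h => -h) = μ) {J : Config n → ℝ} {ε : Config n}
    (hJ : ∀ σ, J (twist ε σ) = J σ) (σ : Config n) :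
    siteProb μ J (twist ε σ) = siteProb μ J σ := by
  have hmp : MeasurePreserving (fun (h : Fin n → ℝ) i => spin (ε i) * h i)
      (Measure.pi fun _ => μ) (Measure.pi fun _ => μ) := by
    refine measurePreserving_pi (f := fun i x => spin (ε i) * x) _ _ fun i => ?_
    refine ⟨by fun_prop, ?_⟩
    cases ε i
    · simpa [spin] using hsymm
    · simp [spin]
  unfold siteProb
  conv_lhs => rw [← hmp.map_eq]
  rw [integral_map hmp.measurable.aemeasurable (measurable_gibbsProb J _).aestronglyMeasurable]
  simp_rw [gibbsProb_twist hJ]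

theorem siteProb_nonneg {n : ℕ} (μ : Measure ℝ) (J : Config n → ℝ) (σ : Config n) :
    0 ≤ siteProb μ J σ := integral_nonneg fun h => gibbsProb_nonneg J h σ

theorem integral_fieldLaw {n : ℕ} {E : Type*} [NormedAddCommGroup E] [NormedSpace ℝ E]
    [CompleteSpace E] (μ : Measure ℝ) [IsProbabilityMeasure μ] (J : Config n → ℝ)
    (F : Config n → E) :
    ∫ σ, F σ ∂(fieldLaw μ J) = ∑ σ, siteProb μ J σ • F σ := by
  unfold fieldLaw
  rw [integral_finsetSum_measure fun σ _ => Integrable.smul_measure (by simp) (by simp)]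
  refine Finset.sum_congr rfl fun σ _ => ?_
  rw [integral_smul_measure, integral_dirac, ENNReal.toReal_ofReal (siteProb_nonneg μ J σ)]

/-- With no interaction every sign change is a symmetry, and sign changes act transitively on
configurations, so all of them have equal weight. -/
theorem siteProb_zero {n : ℕ} (μ : Measure ℝ) [IsProbabilityMeasure μ]
    (hsymm : μ.map (fun h => -h) = μ) (σ : Config n) :
    siteProb μ (fun _ => 0) σ = (1 / 2) ^ n := by
  have h1 : ∀ τ : Config n, siteProb μ (fun _ => 0) τ = siteProb μ (fun _ => 0) σ := fun τ => by
    have := siteProb_twist μ hsymm (J := fun _ => 0) (ε := twist σ τ) (fun _ => rfl) σ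
    rwa [twist_comm, twist_twist] at this
  have h2 := sum_siteProb μ (fun _ : Config n => 0)
  simp only [h1, Finset.sum_const, Finset.card_univ, Fintype.card_fun, Fintype.card_bool,
    Fintype.card_fin, nsmul_eq_mul, Nat.cast_pow, Nat.cast_ofNat] at h2
  rw [one_div, inv_pow]
  exact eq_inv_of_mul_eq_one_right h2

theorem integral_nullLaw {n : ℕ} {E : Type*} [NormedAddCommGroup E] [NormedSpace ℝ E]
    [CompleteSpace E] (μ : Measure ℝ) [IsProbabilityMeasure μ]
    (hsymm : μ.map (fun h => -h) = μ) (F : Config n → E) :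
    ∫ σ, F σ ∂(nullLaw n μ) = ((1 / 2 : ℝ) ^ n) • ∑ σ, F σ := by
  rw [nullLaw, integral_fieldLaw, Finset.smul_sum]
  simp_rw [siteProb_zero μ hsymm]

theorem integral_nullLaw_twist {n : ℕ} {E : Type*} [NormedAddCommGroup E] [NormedSpace ℝ E]
    [CompleteSpace E] (μ : Measure ℝ) [IsProbabilityMeasure μ]
    (hsymm : μ.map (fun h => -h) = μ) (ε : Config n) (F : Config n → E) :
    ∫ σ, F (twist ε σ) ∂(nullLaw n μ) = ∫ σ, F σ ∂(nullLaw n μ) := by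
  rw [integral_nullLaw μ hsymm, integral_nullLaw μ hsymm, sum_twist]

/-- Under the null, the spins are independent and uniform. -/
theorem integral_nullLaw_prod {n : ℕ} {𝕜 : Type*} [RCLike 𝕜] (μ : Measure ℝ)
    [IsProbabilityMeasure μ] (hsymm : μ.map (fun h => -h) = μ) (f : Fin n → Bool → 𝕜) :
    ∫ σ, ∏ i, f i (σ i) ∂(nullLaw n μ) = ∏ i, ((f i true + f i false) / 2) := by
  rw [integral_nullLaw μ hsymm, sum_prod_config, Finset.prod_div_distrib]
  simp [RCLike.real_smul_eq_coe_mul, div_eq_inv_mul, map_ofNat (algebraMap ℝ 𝕜) 2]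

theorem cliqueInteraction_twist {n : ℕ} (θ : ℝ) (S : Finset (Fin n)) {ε : Config n}
    (hε : ∀ i ∈ S, ε i = true) (σ : Config n) :
    cliqueInteraction θ S (twist ε σ) = cliqueInteraction θ S σ := by
  unfold cliqueInteraction
  congr 2
  exact Finset.sum_congr rfl fun i hi => by simp [twist, hε i hi]

/-- Off the clique, the spins are independent of the spins in the clique, and they have the same
law as under the null. -/
theorem integral_cliqueLaw_resample {n : ℕ} {E : Type*} [NormedAddCommGroup E]
    [NormedSpace ℝ E] [CompleteSpace E] (μ : Measure ℝ) [IsProbabilityMeasure μ]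
    (hsymm : μ.map (fun h => -h) = μ) (θ : ℝ) (S : Finset (Fin n)) (g : ℝ → ℝ → E) :
    ∫ σ, g (magnetization S σ) (∑ i ∈ Sᶜ, spin (σ i)) ∂(cliqueLaw μ θ S)
      = ∫ σ, ∫ ε, g (magnetization S σ) (∑ i ∈ Sᶜ, spin (ε i)) ∂(nullLaw n μ)
          ∂(cliqueLaw μ θ S) := by
  classical
  let F : Config n → E := fun σ => g (magnetization S σ) (∑ i ∈ Sᶜ, spin (σ i))
  -- Sign patterns that are trivial on the clique are exactly the ones guaranteed to leave the
  -- interaction invariant.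
  let off : Config n → Config n := fun ε i => if i ∈ S then true else ε i
  have hoff : ∀ ε, ∀ i ∈ S, off ε i = true := fun ε i hi => by simp [off, hi]
  have h1 : ∀ ε, ∫ σ, F (twist (off ε) σ) ∂(cliqueLaw μ θ S) = ∫ σ, F σ ∂(cliqueLaw μ θ S) := by
    intro ε
    rw [cliqueLaw, integral_fieldLaw, integral_fieldLaw, ← sum_twist (off ε)]
    refine Finset.sum_congr rfl fun σ _ => ?_
    rw [siteProb_twist μ hsymm (cliqueInteraction_twist θ S (hoff ε)), twist_twist]
  have h2 : ∀ σ, ∫ ε, F (twist (off ε) σ) ∂(nullLaw n μ)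
      = ∫ ε, g (magnetization S σ) (∑ i ∈ Sᶜ, spin (ε i)) ∂(nullLaw n μ) := by
    intro σ
    -- Under the uniform law `ε` may be replaced by its product with `σ`, which turns the off-clique
    -- spins `ε i * σ i` into `ε i`.
    rw [← integral_nullLaw_twist μ hsymm σ]
    refine integral_congr_ae (Eventually.of_forall fun ε => ?_)
    simp only [F, magnetization]
    congr 1
    · congr 1
      exact Finset.sum_congr rfl fun i hi => by simp [twist, hoff _ i hi]
    · refine Finset.sum_congr rfl fun i hi => ?_
      have hi' : i ∉ S := by simpa using hi
      rw [spin_twist]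
      simp only [off, hi', if_false]
      rw [spin_twist]
      linear_combination spin (ε i) * spin_mul_self (σ i)
  calc ∫ σ, F σ ∂(cliqueLaw μ θ S)
      = ∫ ε, ∫ σ, F (twist (off ε) σ) ∂(cliqueLaw μ θ S) ∂(nullLaw n μ) := by simp [h1]
    _ = ∫ σ, ∫ ε, F (twist (off ε) σ) ∂(nullLaw n μ) ∂(cliqueLaw μ θ S) :=
        integral_integral_swap .of_finite
    _ = _ := by simp_rw [h2]

/-! ### Sums of independent uniform spins -/

theorem integral_nullLaw_exp {n : ℕ} (μ : Measure ℝ) [IsProbabilityMeasure μ]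
    (hsymm : μ.map (fun h => -h) = μ) (A : Finset (Fin n)) (l : ℝ) :
    ∫ σ, Real.exp (l * ∑ i ∈ A, spin (σ i)) ∂(nullLaw n μ) = Real.cosh l ^ A.card := by
  classical
  have h1 : ∀ σ : Config n, Real.exp (l * ∑ i ∈ A, spin (σ i))
      = ∏ i, (if i ∈ A then Real.exp (l * spin (σ i)) else 1) := fun σ => by
    rw [Finset.mul_sum, Real.exp_sum, Finset.prod_ite_mem, Finset.univ_inter]
  simp_rw [h1]
  rw [integral_nullLaw_prod μ hsymm (fun i b => if i ∈ A then Real.exp (l * spin b) else 1)]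
  have h2 : ∀ i : Fin n, ((if i ∈ A then Real.exp (l * spin true) else 1)
      + (if i ∈ A then Real.exp (l * spin false) else 1)) / 2
      = if i ∈ A then Real.cosh l else 1 := fun i => by
    split_ifs <;> simp [spin, Real.cosh_eq]
  simp_rw [h2]
  rw [Finset.prod_ite_mem, Finset.univ_inter, Finset.prod_const]

theorem integral_nullLaw_cexp {n : ℕ} (μ : Measure ℝ) [IsProbabilityMeasure μ]
    (hsymm : μ.map (fun h => -h) = μ) (A : Finset (Fin n)) (t : ℝ) :
    ∫ σ, Complex.exp ((t * ∑ i ∈ A, spin (σ i) : ℝ) * Complex.I) ∂(nullLaw n μ)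
      = (Real.cos t ^ A.card : ℝ) := by
  classical
  have h1 : ∀ σ : Config n, Complex.exp ((t * ∑ i ∈ A, spin (σ i) : ℝ) * Complex.I)
      = ∏ i, (if i ∈ A then Complex.exp ((t * spin (σ i) : ℝ) * Complex.I) else 1) := fun σ => by
    rw [Finset.prod_ite_mem, Finset.univ_inter, ← Complex.exp_sum, Finset.mul_sum]
    push_cast
    rw [Finset.sum_mul]
  simp_rw [h1]
  rw [integral_nullLaw_prod μ hsymm
    (fun i b => if i ∈ A then Complex.exp ((t * spin b : ℝ) * Complex.I) else 1)]
  have h2 : ∀ i : Fin n, ((if i ∈ A then Complex.exp ((t * spin true : ℝ) * Complex.I) else 1)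
      + (if i ∈ A then Complex.exp ((t * spin false : ℝ) * Complex.I) else 1)) / 2
      = if i ∈ A then (Real.cos t : ℂ) else 1 := fun i => by
    split_ifs <;> simp [spin, Complex.cos]
  simp_rw [h2]
  rw [Finset.prod_ite_mem, Finset.univ_inter, Finset.prod_const]
  push_cast; rfl

/-- The characteristic function of the symmetric sum is real, so the shift `y` enters only through
the factor `cos y`. This factorization later yields bounds uniform in the shift. -/
theorem integral_nullLaw_cos {n : ℕ} (μ : Measure ℝ) [IsProbabilityMeasure μ]
    (hsymm : μ.map (fun h => -h) = μ) (A : Finset (Fin n)) (t y : ℝ) :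
    ∫ σ, Real.cos (y + t * ∑ i ∈ A, spin (σ i)) ∂(nullLaw n μ)
      = Real.cos y * Real.cos t ^ A.card := by
  have h := integral_nullLaw_cexp μ hsymm A t
  have hre : ∀ σ : Config n, Real.cos (y + t * ∑ i ∈ A, spin (σ i))
      = RCLike.re (Complex.exp (y * Complex.I)
        * Complex.exp ((t * ∑ i ∈ A, spin (σ i) : ℝ) * Complex.I)) := fun σ => by
    rw [← Complex.exp_add, ← add_mul, ← Complex.ofReal_add]
    exact (Complex.exp_ofReal_mul_I_re _).symm
  simp_rw [hre]
  rw [integral_re .of_finite, integral_const_mul, h]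
  simp only [RCLike.re_eq_complex_re]
  rw [Complex.re_mul_ofReal, Complex.exp_ofReal_mul_I_re]

theorem integral_nullLaw_sum_sq {n : ℕ} (μ : Measure ℝ) [IsProbabilityMeasure μ]
    (hsymm : μ.map (fun h => -h) = μ) (A : Finset (Fin n)) :
    ∫ σ, (∑ i ∈ A, spin (σ i)) ^ 2 ∂(nullLaw n μ) = A.card := by
  classical
  induction A using Finset.induction_on with
  | empty => simp
  | insert a A ha ih =>
    have h0 : ∫ σ, spin (σ a) * ∑ i ∈ A, spin (σ i) ∂(nullLaw n μ) = 0 := by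
      -- Flipping the single spin at `a` changes the sign of the cross term, so its mean vanishes.
      have := integral_nullLaw_twist μ hsymm (fun i => decide (i ≠ a))
        (fun σ => spin (σ a) * ∑ i ∈ A, spin (σ i))
      have h1 : ∀ σ : Config n, spin (twist (fun i => decide (i ≠ a)) σ a)
          * ∑ i ∈ A, spin (twist (fun i => decide (i ≠ a)) σ i)
          = - (spin (σ a) * ∑ i ∈ A, spin (σ i)) := fun σ => by
        rw [spin_twist, Finset.sum_congr rfl (g := fun i => spin (σ i))]
        · have : spin (decide (a ≠ a)) = -1 := by simp [spin]
          rw [this]; ring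
        · intro i hi
          have : i ≠ a := fun h => ha (h ▸ hi)
          rw [spin_twist]; simp [this, spin]
      simp_rw [h1] at this
      rw [integral_neg] at this
      linarith
    have h1 : ∀ σ : Config n, (∑ i ∈ insert a A, spin (σ i)) ^ 2
        = (∑ i ∈ A, spin (σ i)) ^ 2 + (2 * (spin (σ a) * ∑ i ∈ A, spin (σ i)) + 1) := fun σ => by
      rw [Finset.sum_insert ha]
      linear_combination spin_sq (σ a)
    simp_rw [h1]
    rw [integral_add .of_finite .of_finite, integral_add .of_finite .of_finite,
      integral_const_mul, h0, ih, Finset.card_insert_of_notMem ha]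
    simp

theorem integral_nullLaw_abs_sum_le {n : ℕ} (μ : Measure ℝ) [IsProbabilityMeasure μ]
    (hsymm : μ.map (fun h => -h) = μ) (A : Finset (Fin n)) :
    ∫ σ, |∑ i ∈ A, spin (σ i)| ∂(nullLaw n μ) ≤ √A.card := by
  have h := variance_nonneg (fun σ : Config n => |∑ i ∈ A, spin (σ i)|) (nullLaw n μ)
  rw [variance_eq_sub (memLp_of_bounded (a := -(n:ℝ)) (b := n) ?_ ?_ _)] at h
  · simp only [Pi.pow_apply, sq_abs] at h
    rw [integral_nullLaw_sum_sq μ hsymm] at h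
    exact Real.le_sqrt_of_sq_le (by linarith)
  · refine Eventually.of_forall fun σ => ?_
    have : |∑ i ∈ A, spin (σ i)| ≤ n := by
      refine (Finset.abs_sum_le_sum_abs _ _).trans ?_
      simp_rw [abs_spin]
      simpa using A.card_le_univ
    exact ⟨by have := abs_nonneg (∑ i ∈ A, spin (σ i)); linarith, this⟩
  · exact Measurable.of_discrete.aestronglyMeasurable

/-- Sums of independent uniform spins are symmetric. -/
theorem integral_nullLaw_neg_sum {n : ℕ} (μ : Measure ℝ) [IsProbabilityMeasure μ]
    (hsymm : μ.map (fun h => -h) = μ) (A : Finset (Fin n)) (g : ℝ → ℝ) :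
    ∫ σ, g (-∑ i ∈ A, spin (σ i)) ∂(nullLaw n μ) = ∫ σ, g (∑ i ∈ A, spin (σ i)) ∂(nullLaw n μ) := by
  rw [← integral_nullLaw_twist μ hsymm (fun _ => false) (fun σ => g (∑ i ∈ A, spin (σ i)))]
  simp_rw [spin_twist, ← Finset.mul_sum]
  simp [spin]

theorem abs_magnetization_le {n : ℕ} (S : Finset (Fin n)) (σ : Config n) :
    |magnetization S σ| ≤ 1 := by
  unfold magnetization
  rw [abs_div, Nat.abs_cast]
  refine div_le_one_of_le₀ ((Finset.abs_sum_le_sum_abs _ _).trans ?_) (by positivity)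
  simp [abs_spin]

section

/-! ### The mean-field equation -/

theorem hasDerivAt_tanh (x : ℝ) : HasDerivAt Real.tanh ((1 / Real.cosh x) ^ 2) x := by
  have h := (Real.hasDerivAt_sinh x).div (Real.hasDerivAt_cosh x) (Real.cosh_pos x).ne'
  have e : Real.tanh = fun y => Real.sinh y / Real.cosh y := by
    funext y; exact Real.tanh_eq_sinh_div_cosh y
  rw [e]
  convert! h using 1
  rw [div_pow, one_pow]
  congr 1
  linear_combination -Real.cosh_sq x

theorem continuous_tanh : Continuous Real.tanh :=
  continuous_iff_continuousAt.2 fun x => (hasDerivAt_tanh x).continuousAt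

theorem hasDerivAt_log_cosh (x : ℝ) :
    HasDerivAt (fun y => Real.log (Real.cosh y)) (Real.tanh x) x := by
  have h := (Real.hasDerivAt_cosh x).log (Real.cosh_pos x).ne'
  rwa [← Real.tanh_eq_sinh_div_cosh] at h

theorem continuous_log_cosh : Continuous fun y => Real.log (Real.cosh y) :=
  continuous_iff_continuousAt.2 fun x => (hasDerivAt_log_cosh x).continuousAt

theorem abs_log_cosh_sub_le (a b : ℝ) :
    |Real.log (Real.cosh a) - Real.log (Real.cosh b)| ≤ |a - b| := by
  have := convex_univ.norm_image_sub_le_of_norm_hasDerivWithin_le (C := 1)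
    (fun x _ => (hasDerivAt_log_cosh x).hasDerivWithinAt)
    (fun x _ => (Real.abs_tanh_lt_one x).le) (Set.mem_univ b) (Set.mem_univ a)
  simpa using this

/-- The map `y ↦ E[tanh (θ y + h)]`. -/
noncomputable def meanTanh (μ : Measure ℝ) (θ y : ℝ) : ℝ := ∫ h, Real.tanh (θ * y + h) ∂μ

/-- The limiting free energy, as a function of the magnetization on the clique. -/
noncomputable def freeEnergy (μ : Measure ℝ) (θ y : ℝ) : ℝ :=
  θ * y ^ 2 / 2 - ∫ h, (Real.log (Real.cosh (θ * y + h)) - Real.log (Real.cosh h)) ∂μ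

variable {μ : Measure ℝ} {θ : ℝ}

theorem integral_comp_neg_of_symm (hsymm : μ.map (fun h => -h) = μ) {f : ℝ → ℝ}
    (hf : Continuous f) : ∫ h, f (-h) ∂μ = ∫ h, f h ∂μ := by
  conv_rhs => rw [← hsymm]
  rw [integral_map (by fun_prop) hf.aestronglyMeasurable]

theorem meanTanh_zero (hsymm : μ.map (fun h => -h) = μ) : meanTanh μ θ 0 = 0 := by
  have := integral_comp_neg_of_symm hsymm continuous_tanh
  simp only [Real.tanh_neg, integral_neg] at this
  simp only [meanTanh, mul_zero, zero_add]
  linarith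

theorem freeEnergy_neg (hsymm : μ.map (fun h => -h) = μ) (y : ℝ) :
    freeEnergy μ θ (-y) = freeEnergy μ θ y := by
  have := integral_comp_neg_of_symm hsymm
    (f := fun h => Real.log (Real.cosh (θ * y + h)) - Real.log (Real.cosh h))
    ((continuous_log_cosh.comp (by fun_prop)).sub continuous_log_cosh)
  unfold freeEnergy
  rw [← this, neg_sq]
  congr 2
  funext h
  rw [Real.cosh_neg, ← Real.cosh_neg (θ * y + -h)]
  ring_nf

theorem freeEnergy_abs (hsymm : μ.map (fun h => -h) = μ) (y : ℝ) :
    freeEnergy μ θ |y| = freeEnergy μ θ y := by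
  rcases abs_choice y with h | h <;> rw [h]
  exact freeEnergy_neg hsymm y

variable [IsProbabilityMeasure μ]

theorem integrable_tanh (a : ℝ) : Integrable (fun h => Real.tanh (a + h)) μ :=
  Integrable.of_bound (C := 1)
    (continuous_tanh.comp (by fun_prop)).aestronglyMeasurable
    (Eventually.of_forall fun h => (Real.abs_tanh_lt_one _).le)

theorem integrable_log_cosh_sub (a b : ℝ) :
    Integrable (fun h => Real.log (Real.cosh (a + h)) - Real.log (Real.cosh (b + h))) μ := by
  refine Integrable.of_bound (C := |a - b|) ?_ (Eventually.of_forall fun h => ?_)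
  · exact ((continuous_log_cosh.comp (continuous_const.add continuous_id)).sub
      (continuous_log_cosh.comp (continuous_const.add continuous_id))).aestronglyMeasurable
  · refine (abs_log_cosh_sub_le _ _).trans ?_
    simp

theorem hasDerivAt_meanTanh (y : ℝ) :
    HasDerivAt (meanTanh μ θ) (∫ h, (1 / Real.cosh (θ * y + h)) ^ 2 * θ ∂μ) y := by
  have hc : Continuous fun h : ℝ => (1 / Real.cosh (θ * y + h)) ^ 2 * θ := by
    have : ∀ h : ℝ, Real.cosh (θ * y + h) ≠ 0 := fun h => (Real.cosh_pos _).ne'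
    fun_prop (disch := assumption)
  refine (hasDerivAt_integral_of_dominated_loc_of_deriv_le (μ := μ) (s := Set.univ)
    (F := fun y h => Real.tanh (θ * y + h))
    (F' := fun y h => (1 / Real.cosh (θ * y + h)) ^ 2 * θ) (bound := fun _ => |θ|)
    univ_mem ?_ (integrable_tanh _) hc.aestronglyMeasurable ?_ (integrable_const _) ?_).2
  · exact Eventually.of_forall fun z => (integrable_tanh _).aestronglyMeasurable
  · refine Eventually.of_forall fun h z _ => ?_
    rw [norm_mul, Real.norm_eq_abs, Real.norm_eq_abs, abs_of_nonneg (sq_nonneg _)]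
    refine mul_le_of_le_one_left (abs_nonneg _) (pow_le_one₀ ?_ ?_)
    · have := Real.cosh_pos (θ * z + h); positivity
    · rw [div_le_one (Real.cosh_pos _)]; exact Real.one_le_cosh _
  · refine Eventually.of_forall fun h z _ => ?_
    have h1 : HasDerivAt (fun z : ℝ => θ * z + h) θ z := by
      simpa using ((hasDerivAt_id z).const_mul θ).add_const h
    exact (hasDerivAt_tanh _).comp z h1

theorem continuous_meanTanh : Continuous (meanTanh μ θ) :=
  continuous_iff_continuousAt.2 fun y => (hasDerivAt_meanTanh y).continuousAt

/-- This links the mean-field equation to the large deviations: for `θ > 0` the critical points are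
the solutions of `y = meanTanh μ θ y`, and comparing `y` with `meanTanh` gives the monotonicity of
the free energy. -/
theorem hasDerivAt_freeEnergy (y : ℝ) :
    HasDerivAt (freeEnergy μ θ) (θ * (y - meanTanh μ θ y)) y := by
  have h2 : HasDerivAt (fun y => θ * y ^ 2 / 2) (θ * y) y := by
    have := ((hasDerivAt_pow 2 y).const_mul θ).div_const 2
    convert! this using 1
    simp; ring
  have h1 := (hasDerivAt_integral_of_dominated_loc_of_deriv_le (μ := μ) (s := Set.univ) (x₀ := y)
    (F := fun y h => Real.log (Real.cosh (θ * y + h)) - Real.log (Real.cosh h))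
    (F' := fun y h => Real.tanh (θ * y + h) * θ) (bound := fun _ => |θ|)
    univ_mem ?_ ?_ ((integrable_tanh _).mul_const θ).aestronglyMeasurable ?_
    (integrable_const _) ?_).2
  · convert! h2.sub h1 using 1
    rw [integral_mul_const]
    unfold meanTanh
    ring
  · refine Eventually.of_forall fun z => ?_
    simpa using (integrable_log_cosh_sub (μ := μ) (θ * z) 0).aestronglyMeasurable
  · simpa using (integrable_log_cosh_sub (μ := μ) (θ * y) 0)
  · refine Eventually.of_forall fun h z _ => ?_
    rw [norm_mul, Real.norm_eq_abs, Real.norm_eq_abs]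
    exact mul_le_of_le_one_left (abs_nonneg _) (Real.abs_tanh_lt_one _).le
  · refine Eventually.of_forall fun h z _ => ?_
    have h1 : HasDerivAt (fun z : ℝ => θ * z + h) θ z := by
      simpa using ((hasDerivAt_id z).const_mul θ).add_const h
    exact ((hasDerivAt_log_cosh _).comp z h1).sub_const _

theorem meanSechSq_pos : 0 < meanSechSq μ := by
  unfold meanSechSq
  have hpos : ∀ h : ℝ, 0 < (1 / Real.cosh h) ^ 2 := fun h => by
    have := Real.cosh_pos h; positivity
  have hc : Continuous fun h : ℝ => (1 / Real.cosh h) ^ 2 := by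
    have : ∀ h : ℝ, Real.cosh h ≠ 0 := fun h => (Real.cosh_pos _).ne'
    fun_prop (disch := assumption)
  have hi : Integrable (fun h : ℝ => (1 / Real.cosh h) ^ 2) μ := by
    refine Integrable.of_bound (C := 1) hc.aestronglyMeasurable (Eventually.of_forall fun h => ?_)
    rw [Real.norm_of_nonneg (hpos h).le]
    refine pow_le_one₀ (by have := Real.cosh_pos h; positivity) ?_
    rw [div_le_one (Real.cosh_pos _)]; exact Real.one_le_cosh _
  rw [integral_pos_iff_support_of_nonneg (fun h => (hpos h).le) hi]
  rw [Function.support_eq_univ fun h => (hpos h).ne']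
  simp

theorem meanTanh_le_one (y : ℝ) : meanTanh μ θ y ≤ 1 := by
  have := integral_mono (μ := μ) (integrable_tanh (θ * y)) (integrable_const (1 : ℝ))
    fun h => (Real.tanh_lt_one _).le
  simpa [meanTanh] using this

theorem theta_pos (hlow : 1 / meanSechSq μ < θ) : 0 < θ :=
  (one_div_pos.2 meanSechSq_pos).trans hlow

/-- Below the critical temperature, `y < E[tanh (θ y + h)]` for small positive `y`. -/
theorem exists_lt_meanTanh (hsymm : μ.map (fun h => -h) = μ) (hlow : 1 / meanSechSq μ < θ) :
    ∃ r > 0, ∀ y, 0 < y → y < r → y < meanTanh μ θ y := by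
  have h1 : HasDerivAt (meanTanh μ θ) (meanSechSq μ * θ) 0 := by
    have := hasDerivAt_meanTanh (μ := μ) (θ := θ) 0
    simp only [mul_zero, zero_add] at this
    rwa [integral_mul_const] at this
  have h2 : 1 < meanSechSq μ * θ := by
    rw [div_lt_iff₀ meanSechSq_pos] at hlow
    linarith
  have h3 := (hasDerivAt_iff_tendsto_slope.1 h1).eventually (lt_mem_nhds h2)
  rw [eventually_nhdsWithin_iff, Metric.eventually_nhds_iff] at h3
  obtain ⟨r, hr, h⟩ := h3
  refine ⟨r, hr, fun y hy hyr => ?_⟩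
  have := h (y := y) (by simpa [abs_of_pos hy] using hyr) (by simpa using hy.ne')
  rw [slope_def_field, meanTanh_zero hsymm, sub_zero, sub_zero, lt_div_iff₀ hy] at this
  linarith

/-- The mean-field equation has a smallest positive solution `x`, and `y < E[tanh (θ y + h)]` for
`0 < y < x`. -/
theorem exists_isLeast_positiveSolutions (hsymm : μ.map (fun h => -h) = μ)
    (hlow : 1 / meanSechSq μ < θ) :
    ∃ x, IsLeast (positiveSolutions μ θ) x ∧ ∀ y, 0 < y → y < x → y < meanTanh μ θ y := by
  obtain ⟨r, hr, hlt⟩ := exists_lt_meanTanh hsymm hlow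
  have hcont : Continuous fun y => meanTanh μ θ y - y := continuous_meanTanh.sub continuous_id
  have hzero : ∀ a b : ℝ, a ≤ b → a < meanTanh μ θ a → meanTanh μ θ b ≤ b →
      ∃ z, a < z ∧ z ≤ b ∧ meanTanh μ θ z = z := by
    intro a b hab ha hb
    obtain ⟨z, hz, h0⟩ := intermediate_value_Icc' hab hcont.continuousOn
      (show (0 : ℝ) ∈ Set.Icc _ _ from ⟨by linarith, by linarith⟩)
    refine ⟨z, lt_of_le_of_ne hz.1 ?_, hz.2, by simpa [sub_eq_zero] using h0⟩
    rintro rfl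
    simp only at h0
    linarith
  -- The left endpoint lies in the region where `y < meanTanh y`, which cuts off the trivial
  -- solution `0`; the bound `meanTanh ≤ 1` keeps all solutions below `2`. By compactness a smallest
  -- solution exists.
  let Z : Set ℝ := Set.Icc (min r 2 / 2) 2 ∩ {y | meanTanh μ θ y - y = 0}
  have hm : 0 < min r 2 := lt_min hr two_pos
  have hZc : IsCompact Z := isCompact_Icc.inter_right (isClosed_eq hcont continuous_const)
  have hZne : Z.Nonempty := by
    obtain ⟨z, h1, h2, h3⟩ := hzero (min r 2 / 2) 2 (by have := min_le_right r 2; linarith)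
      (hlt _ (by linarith) (by have := min_le_left r 2; linarith))
      ((meanTanh_le_one _).trans one_le_two)
    exact ⟨z, ⟨h1.le, h2⟩, by simp [h3]⟩
  obtain ⟨x, hxZ, hx⟩ := hZc.exists_isLeast hZne
  have hx0 : 0 < x := by linarith [hxZ.1.1]
  have hxeq : meanTanh μ θ x = x := by simpa [sub_eq_zero] using hxZ.2
  have hleast : IsLeast (positiveSolutions μ θ) x := by
    refine ⟨⟨hx0, hxeq.symm⟩, fun y hy => hx ?_⟩
    have hy2 : y = meanTanh μ θ y := hy.2
    refine ⟨⟨?_, ?_⟩, ?_⟩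
    · by_contra hlt'
      push Not at hlt'
      have := hlt y hy.1 (by have := min_le_left r 2; linarith)
      linarith
    · have := meanTanh_le_one (μ := μ) (θ := θ) y; linarith
    · simp [← hy2]
  refine ⟨x, hleast, fun y hy hyx => ?_⟩
  -- A failure at some `y < x` would, by the intermediate value theorem, create a positive solution
  -- at most `y`, against minimality.
  by_contra hle
  push Not at hle
  have hw : 0 < min r y / 2 := by have := lt_min hr hy; linarith
  obtain ⟨z, h1, h2, h3⟩ := hzero (min r y / 2) y (by have := min_le_right r y; linarith)
    (hlt _ hw (by have := min_le_left r y; linarith)) hle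
  have := hleast.2 (show z ∈ positiveSolutions μ θ from ⟨hw.trans h1, h3.symm⟩)
  linarith

theorem positiveSolutions_le_one {x : ℝ} (hx : x ∈ positiveSolutions μ θ) : x ≤ 1 := by
  rw [hx.2]; exact meanTanh_le_one x

/-- If `x` is the only positive solution, then `E[tanh (θ y + h)] < y` for `y > x`. -/
theorem meanTanh_lt_of_unique {x : ℝ} (hx : x ∈ positiveSolutions μ θ)
    (huniq : ∀ y ∈ positiveSolutions μ θ, y = x) (y : ℝ) (hxy : x < y) : meanTanh μ θ y < y := by
  by_contra hle
  push Not at hle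
  have hcont : Continuous fun y => meanTanh μ θ y - y := continuous_meanTanh.sub continuous_id
  have hy1 := meanTanh_le_one (μ := μ) (θ := θ) y
  have h2 := meanTanh_le_one (μ := μ) (θ := θ) 2
  obtain ⟨z, hz, h0⟩ := intermediate_value_Icc' (by linarith : y ≤ 2) hcont.continuousOn
      (show (0 : ℝ) ∈ Set.Icc _ _ from ⟨by linarith, by linarith⟩)
  have hz' : meanTanh μ θ z = z := by simpa [sub_eq_zero] using h0
  have := huniq z ⟨by linarith [hz.1, hx.1], hz'.symm⟩
  linarith [hz.1]

theorem freeEnergy_strictAntiOn (hθ : 0 < θ) {x : ℝ}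
    (hbelow : ∀ y, 0 < y → y < x → y < meanTanh μ θ y) :
    StrictAntiOn (freeEnergy μ θ) (Set.Icc 0 x) := by
  refine strictAntiOn_of_deriv_neg (convex_Icc 0 x)
    (fun y _ => (hasDerivAt_freeEnergy y).continuousAt.continuousWithinAt) fun y hy => ?_
  rw [interior_Icc] at hy
  rw [(hasDerivAt_freeEnergy y).deriv]
  exact mul_neg_of_pos_of_neg hθ (by linarith [hbelow y hy.1 hy.2])

/-- By evenness and monotonicity, the least free energy on `|y| ≤ τ` is attained at `τ`. Only the
behaviour below `x` matters: `x` need not be a global minimizer when there are larger solutions. -/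
theorem freeEnergy_gap (hsymm : μ.map (fun h => -h) = μ) (hθ : 0 < θ) {x τ : ℝ}
    (hbelow : ∀ y, 0 < y → y < x → y < meanTanh μ θ y) (hτ : 0 < τ) (hτx : τ < x) :
    ∃ δ > 0, ∀ y, |y| ≤ τ → freeEnergy μ θ x + δ ≤ freeEnergy μ θ y := by
  have hanti := freeEnergy_strictAntiOn hθ hbelow
  refine ⟨freeEnergy μ θ τ - freeEnergy μ θ x, ?_, fun y hy => ?_⟩
  · exact sub_pos.2 (hanti ⟨hτ.le, hτx.le⟩ ⟨by linarith, le_rfl⟩ hτx)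
  · rw [← freeEnergy_abs hsymm y]
    have := hanti.antitoneOn ⟨abs_nonneg y, hy.trans hτx.le⟩ ⟨hτ.le, hτx.le⟩ hy
    linarith

theorem freeEnergy_gap_of_unique (hsymm : μ.map (fun h => -h) = μ) (hθ : 0 < θ) {x ε : ℝ}
    (hx : x ∈ positiveSolutions μ θ)
    (hbelow : ∀ y, 0 < y → y < x → y < meanTanh μ θ y)
    (huniq : ∀ y ∈ positiveSolutions μ θ, y = x) (hε : 0 < ε) :
    ∃ δ > 0, ∀ y, ε ≤ |(|y| - x)| → freeEnergy μ θ x + δ ≤ freeEnergy μ θ y := by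
  have hanti := freeEnergy_strictAntiOn hθ hbelow
  have hmono : StrictMonoOn (freeEnergy μ θ) (Set.Ici x) := by
    refine strictMonoOn_of_deriv_pos (convex_Ici x)
      (fun y _ => (hasDerivAt_freeEnergy y).continuousAt.continuousWithinAt) fun y hy => ?_
    rw [interior_Ici] at hy
    rw [(hasDerivAt_freeEnergy y).deriv]
    exact mul_pos hθ (by linarith [meanTanh_lt_of_unique hx huniq y hy])
  have hx0 : 0 < x := hx.1
  -- Truncation at `0` keeps the left comparison point in the interval of monotonicity when `ε > x`.
  have hm : max (x - ε) 0 < x := max_lt (by linarith) hx0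
  have h1 : freeEnergy μ θ x < freeEnergy μ θ (max (x - ε) 0) :=
    hanti ⟨le_max_right _ _, hm.le⟩ ⟨hx0.le, le_rfl⟩ hm
  have h2 : freeEnergy μ θ x < freeEnergy μ θ (x + ε) :=
    hmono (Set.mem_Ici.2 le_rfl) (Set.mem_Ici.2 (by linarith)) (by linarith)
  refine ⟨min (freeEnergy μ θ (max (x - ε) 0) - freeEnergy μ θ x)
    (freeEnergy μ θ (x + ε) - freeEnergy μ θ x), lt_min (by linarith) (by linarith),
    fun y hy => ?_⟩
  rw [← freeEnergy_abs hsymm y]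
  rcases le_abs.1 hy with h | h
  · have := hmono.monotoneOn (Set.mem_Ici.2 (by linarith : x ≤ x + ε))
      (Set.mem_Ici.2 (by linarith : x ≤ |y|)) (by linarith)
    have := min_le_right (freeEnergy μ θ (max (x - ε) 0) - freeEnergy μ θ x)
      (freeEnergy μ θ (x + ε) - freeEnergy μ θ x)
    linarith
  · have h3 : |y| ≤ max (x - ε) 0 := le_max_of_le_left (by linarith)
    have := hanti.antitoneOn ⟨abs_nonneg y, h3.trans hm.le⟩ ⟨le_max_right _ _, hm.le⟩ h3
    have := min_le_left (freeEnergy μ θ (max (x - ε) 0) - freeEnergy μ θ x)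
      (freeEnergy μ θ (x + ε) - freeEnergy μ θ x)
    linarith

end

section

/-! ### Large deviations of the magnetization on the clique -/

/-- Log-ratio of the tilted single-site partition functions at magnetizations `y` and `x`. -/
noncomputable def siteRatio (θ x y h : ℝ) : ℝ :=
  Real.log (Real.cosh (θ * y + h)) - Real.log (Real.cosh (θ * x + h)) - θ * (y ^ 2 - x ^ 2) / 2

theorem sum_exp_field {n : ℕ} (h : Fin n → ℝ) :
    ∑ σ : Config n, Real.exp (∑ i, h i * spin (σ i)) = ∏ i, (2 * Real.cosh (h i)) := by
  simp_rw [Real.exp_sum]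
  rw [sum_prod_config (fun i b => Real.exp (h i * spin b))]
  refine Finset.prod_congr rfl fun i _ => ?_
  rw [Real.cosh_eq]
  simp [spin]
  ring

/-- Partition function of the interaction linearized at magnetization `y`. -/
theorem sum_exp_linearized {n : ℕ} (θ y : ℝ) (S : Finset (Fin n)) (h : Fin n → ℝ) :
    ∑ σ : Config n, Real.exp (θ * y * ∑ i ∈ S, spin (σ i) - S.card * (θ * y ^ 2 / 2)
        + ∑ i, h i * spin (σ i))
      = Real.exp (-(S.card * (θ * y ^ 2 / 2))
        + ∑ i, Real.log (2 * Real.cosh (h i + if i ∈ S then θ * y else 0))) := by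
  have h1 : ∀ σ : Config n, θ * y * ∑ i ∈ S, spin (σ i) - S.card * (θ * y ^ 2 / 2)
        + ∑ i, h i * spin (σ i)
      = -(S.card * (θ * y ^ 2 / 2)) + ∑ i, (h i + if i ∈ S then θ * y else 0) * spin (σ i) := by
    intro σ
    simp_rw [add_mul, ite_mul, zero_mul]
    rw [Finset.sum_add_distrib, Finset.sum_ite_mem, Finset.univ_inter, ← Finset.mul_sum]
    ring
  simp_rw [h1, Real.exp_add]
  rw [← Finset.mul_sum, sum_exp_field, Real.exp_sum]
  congr 1
  refine Finset.prod_congr rfl fun i _ => ?_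
  rw [Real.exp_log]
  have := Real.cosh_pos (h i + if i ∈ S then θ * y else 0)
  positivity

/-- Both linearized partition functions factor over sites. The factors off the clique agree, and
each clique site contributes the exponential of its `siteRatio`. -/
theorem sum_exp_linearized_eq {n : ℕ} (θ x y : ℝ) (S : Finset (Fin n)) (h : Fin n → ℝ) :
    ∑ σ : Config n, Real.exp (θ * y * ∑ i ∈ S, spin (σ i) - S.card * (θ * y ^ 2 / 2)
        + ∑ i, h i * spin (σ i))
      = Real.exp (∑ i ∈ S, siteRatio θ x y (h i)) *
        ∑ σ : Config n, Real.exp (θ * x * ∑ i ∈ S, spin (σ i) - S.card * (θ * x ^ 2 / 2)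
        + ∑ i, h i * spin (σ i)) := by
  rw [sum_exp_linearized, sum_exp_linearized, ← Real.exp_add]
  congr 1
  have h1 : ∑ i, Real.log (2 * Real.cosh (h i + if i ∈ S then θ * y else 0))
      - ∑ i, Real.log (2 * Real.cosh (h i + if i ∈ S then θ * x else 0))
      = ∑ i ∈ S, (Real.log (Real.cosh (θ * y + h i)) - Real.log (Real.cosh (θ * x + h i))) := by
    rw [← Finset.sum_sub_distrib, ← Finset.univ_inter S, ← Finset.sum_ite_mem]
    refine Finset.sum_congr rfl fun i _ => ?_
    by_cases hi : i ∈ S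
    · simp only [hi, if_true, Finset.univ_inter]
      rw [Real.log_mul two_ne_zero (Real.cosh_pos _).ne',
        Real.log_mul two_ne_zero (Real.cosh_pos _).ne', add_comm (h i), add_comm (h i)]
      ring
    · simp [hi]
  unfold siteRatio
  rw [Finset.sum_sub_distrib, ← h1]
  simp only [Finset.sum_const, nsmul_eq_mul]
  ring

/-- Quenched upper bound for the probability of a given magnetization on the clique. -/
theorem sum_gibbsProb_magnetization_le {n : ℕ} {θ : ℝ} (hθ : 0 < θ) (x y : ℝ)
    (S : Finset (Fin n)) (hS : 0 < S.card) (h : Fin n → ℝ) :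
    ∑ σ : Config n, (if magnetization S σ = y then gibbsProb (cliqueInteraction θ S) h σ else 0)
      ≤ Real.exp (∑ i ∈ S, siteRatio θ x y (h i)) := by
  have hk : (0 : ℝ) < S.card := by exact_mod_cast hS
  -- The quadratic interaction exceeds its linearization at `x` by a nonnegative square, which
  -- bounds the true partition function from below.
  have hZ : ∑ σ : Config n, Real.exp (θ * x * ∑ i ∈ S, spin (σ i) - S.card * (θ * x ^ 2 / 2)
        + ∑ i, h i * spin (σ i))
      ≤ ∑ σ : Config n, Real.exp (cliqueInteraction θ S σ + ∑ i, h i * spin (σ i)) := by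
    refine Finset.sum_le_sum fun σ _ => Real.exp_le_exp.2 ?_
    have : cliqueInteraction θ S σ - (θ * x * ∑ i ∈ S, spin (σ i) - S.card * (θ * x ^ 2 / 2))
        = θ / (2 * S.card) * (∑ i ∈ S, spin (σ i) - S.card * x) ^ 2 := by
      unfold cliqueInteraction
      field_simp
      ring
    have h0 : 0 ≤ θ / (2 * S.card) * (∑ i ∈ S, spin (σ i) - S.card * x) ^ 2 := by positivity
    linarith
  have hZpos : 0 < ∑ σ : Config n,
      Real.exp (cliqueInteraction θ S σ + ∑ i, h i * spin (σ i)) :=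
    Finset.sum_pos (fun _ _ => Real.exp_pos _) Finset.univ_nonempty
  unfold gibbsProb
  have h1 : ∀ σ : Config n, (if magnetization S σ = y then
      Real.exp (cliqueInteraction θ S σ + ∑ i, h i * spin (σ i)) /
        ∑ τ : Config n, Real.exp (cliqueInteraction θ S τ + ∑ i, h i * spin (τ i)) else 0)
      = (if magnetization S σ = y then
      Real.exp (cliqueInteraction θ S σ + ∑ i, h i * spin (σ i)) else 0) /
        ∑ τ : Config n, Real.exp (cliqueInteraction θ S τ + ∑ i, h i * spin (τ i)) := fun σ => by
    split_ifs <;> simp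
  simp_rw [h1]
  rw [← Finset.sum_div, div_le_iff₀ hZpos]
  calc ∑ σ : Config n, (if magnetization S σ = y then
          Real.exp (cliqueInteraction θ S σ + ∑ i, h i * spin (σ i)) else 0)
      ≤ ∑ σ : Config n, Real.exp (θ * y * ∑ i ∈ S, spin (σ i) - S.card * (θ * y ^ 2 / 2)
        + ∑ i, h i * spin (σ i)) := by
        refine Finset.sum_le_sum fun σ _ => ?_
        split_ifs with hy
        -- On the event that the magnetization is `y` the linearization at `y` is exact; the other
        -- configurations only add positive terms.
        · refine Real.exp_le_exp.2 (le_of_eq ?_)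
          congr 1
          unfold magnetization at hy
          unfold cliqueInteraction
          rw [← hy]
          field_simp
          ring
        · positivity
    _ = _ := sum_exp_linearized_eq θ x y S h
    _ ≤ _ := mul_le_mul_of_nonneg_left hZ (Real.exp_pos _).le

theorem real_fieldLaw {n : ℕ} (μ : Measure ℝ) [IsProbabilityMeasure μ] (J : Config n → ℝ)
    (p : Config n → Prop) [DecidablePred p] :
    (fieldLaw μ J).real {σ | p σ} = ∑ σ, if p σ then siteProb μ J σ else 0 := by
  rw [← integral_indicator_one (Set.toFinite _).measurableSet, integral_fieldLaw]
  refine Finset.sum_congr rfl fun σ _ => ?_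
  simp [Set.indicator_apply]

variable {μ : Measure ℝ} [IsProbabilityMeasure μ] {θ : ℝ}

theorem continuous_siteRatio (θ x y : ℝ) : Continuous (siteRatio θ x y) := by
  unfold siteRatio
  exact ((continuous_log_cosh.comp (continuous_const.add continuous_id)).sub
      (continuous_log_cosh.comp (continuous_const.add continuous_id))).sub continuous_const

theorem abs_siteRatio_le (hθ : 0 < θ) {x y : ℝ} (hx : |x| ≤ 1) (hy : |y| ≤ 1) (h : ℝ) :
    |siteRatio θ x y h| ≤ 3 * θ := by
  unfold siteRatio
  refine (abs_sub _ _).trans ?_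
  have h1 := abs_log_cosh_sub_le (θ * y + h) (θ * x + h)
  have h2 : |θ * y + h - (θ * x + h)| ≤ 2 * θ := by
    rw [show θ * y + h - (θ * x + h) = θ * (y - x) by ring, abs_mul, abs_of_pos hθ]
    have := (abs_sub y x).trans (add_le_add hy hx)
    nlinarith
  have h3 : |θ * (y ^ 2 - x ^ 2) / 2| ≤ θ := by
    rw [abs_div, abs_mul, abs_of_pos hθ, abs_two]
    have : |y ^ 2 - x ^ 2| ≤ 1 := by
      have a := (sq_le_one_iff_abs_le_one x).2 hx
      have b := (sq_le_one_iff_abs_le_one y).2 hy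
      rw [abs_le]; constructor <;> nlinarith [sq_nonneg x, sq_nonneg y]
    nlinarith
  linarith

theorem integral_siteRatio (x y : ℝ) :
    ∫ h, siteRatio θ x y h ∂μ = freeEnergy μ θ x - freeEnergy μ θ y := by
  have h0 : ∀ z, Integrable
      (fun h => Real.log (Real.cosh (θ * z + h)) - Real.log (Real.cosh h)) μ := fun z => by
    simpa using integrable_log_cosh_sub (μ := μ) (θ * z) 0
  have h1 : ∀ h, siteRatio θ x y h
      = ((Real.log (Real.cosh (θ * y + h)) - Real.log (Real.cosh h))
        - (Real.log (Real.cosh (θ * x + h)) - Real.log (Real.cosh h)))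
        - θ * (y ^ 2 - x ^ 2) / 2 := fun h => by unfold siteRatio; ring
  have h2 : Integrable (fun h => (Real.log (Real.cosh (θ * y + h)) - Real.log (Real.cosh h))
        - (Real.log (Real.cosh (θ * x + h)) - Real.log (Real.cosh h))) μ := (h0 y).sub (h0 x)
  simp_rw [h1]
  rw [integral_sub h2 (integrable_const _), integral_sub (h0 y) (h0 x)]
  unfold freeEnergy
  simp
  ring

/-- Exponential moment bound for a bounded random variable with negative mean. -/
theorem exists_integral_exp_le {B δ : ℝ} (hB : 0 < B) (hδ : 0 < δ) :
    ∃ l > 0, l ≤ 1 ∧ ∃ c > 0, ∀ f : ℝ → ℝ, Continuous f → (∀ h, |f h| ≤ B) →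
      ∫ h, f h ∂μ ≤ -δ → ∫ h, Real.exp (l * f h) ∂μ ≤ Real.exp (-c) := by
  -- The condition `l * B ≤ 1` allows `exp u ≤ 1 + u + u²`, and `l * B² ≤ δ / 2` makes the quadratic
  -- term at most half of the linear gain `l * δ`. Since `l` depends only on `B` and `δ`, the bound
  -- is uniform over the possible magnetizations, which vary with the clique size.
  obtain ⟨l, hl0, hl1, hlB, hlδ⟩ : ∃ l > 0, l ≤ 1 ∧ l * B ≤ 1 ∧ l * B ^ 2 ≤ δ / 2 := by
    refine ⟨min 1 (min (1 / B) (δ / (2 * B ^ 2))), by positivity, min_le_left _ _, ?_, ?_⟩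
    · rw [← le_div_iff₀ hB]
      exact (min_le_right _ _).trans (min_le_left _ _)
    · rw [← le_div_iff₀ (by positivity), div_div]
      exact (min_le_right _ _).trans (min_le_right _ _)
  refine ⟨l, hl0, hl1, l * δ / 2, by positivity, fun f hf hfB hfδ => ?_⟩
  have hi : Integrable f μ := Integrable.of_bound (C := B) hf.aestronglyMeasurable
    (Eventually.of_forall hfB)
  have hpt : ∀ h, Real.exp (l * f h) ≤ 1 + l * f h + l ^ 2 * B ^ 2 := fun h => by
    have h1 : |l * f h| ≤ 1 := by
      rw [abs_mul, abs_of_pos hl0]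
      exact (mul_le_mul_of_nonneg_left (hfB h) hl0.le).trans hlB
    have h2 := (abs_le.1 (Real.abs_exp_sub_one_sub_id_le h1)).2
    have h3 : (l * f h) ^ 2 ≤ l ^ 2 * B ^ 2 := by
      rw [mul_pow]
      exact mul_le_mul_of_nonneg_left (sq_le_sq' (abs_le.1 (hfB h)).1 (abs_le.1 (hfB h)).2)
        (by positivity)
    linarith
  have hi1 : Integrable (fun h => 1 + l * f h) μ := (integrable_const _).add (hi.const_mul l)
  have hi2 : Integrable (fun h => 1 + l * f h + l ^ 2 * B ^ 2) μ := hi1.add (integrable_const _)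
  calc ∫ h, Real.exp (l * f h) ∂μ ≤ ∫ h, (1 + l * f h + l ^ 2 * B ^ 2) ∂μ :=
        integral_mono_of_nonneg (Eventually.of_forall fun h => (Real.exp_pos _).le) hi2
          (Eventually.of_forall hpt)
    _ = 1 + l * ∫ h, f h ∂μ + l ^ 2 * B ^ 2 := by
        rw [integral_add hi1 (integrable_const _),
          integral_add (integrable_const _) (hi.const_mul l), integral_const_mul]
        simp
    _ ≤ -(l * δ / 2) + 1 := by nlinarith
    _ ≤ _ := Real.add_one_le_exp _

/-- Annealed upper bound for the probability of a given magnetization on the clique. -/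
theorem cliqueLaw_magnetization_eq_le {n : ℕ} (hθ : 0 < θ) {x y l c : ℝ} (hl0 : 0 < l)
    (hl1 : l ≤ 1) (hx : |x| ≤ 1) (hy : |y| ≤ 1) (S : Finset (Fin n)) (hS : 0 < S.card)
    (hc : ∫ h, Real.exp (l * siteRatio θ x y h) ∂μ ≤ Real.exp (-c)) :
    (cliqueLaw μ θ S).real {σ | magnetization S σ = y} ≤ Real.exp (-c * S.card) := by
  classical
  have hi : ∀ σ : Config n, Integrable (fun h => if magnetization S σ = y then
      gibbsProb (cliqueInteraction θ S) h σ else 0) (Measure.pi fun _ : Fin n => μ) := fun σ => by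
    split_ifs
    · exact integrable_gibbsProb μ _ σ
    · simp
  have hbd : Integrable (fun h : Fin n → ℝ => Real.exp (l * ∑ i ∈ S, siteRatio θ x y (h i)))
      (Measure.pi fun _ : Fin n => μ) := by
    refine Integrable.of_bound (C := Real.exp (l * (S.card * (3 * θ)))) ?_
      (Eventually.of_forall fun h => ?_)
    · refine Continuous.aestronglyMeasurable (Real.continuous_exp.comp (continuous_const.mul
        (continuous_finsetSum _ fun i _ => (continuous_siteRatio θ x y).comp
          (continuous_apply i))))
    · rw [Real.norm_of_nonneg (Real.exp_pos _).le]
      refine Real.exp_le_exp.2 (mul_le_mul_of_nonneg_left ?_ hl0.le)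
      have := Finset.sum_le_card_nsmul S (fun i => siteRatio θ x y (h i)) (3 * θ)
        fun i _ => (le_abs_self _).trans (abs_siteRatio_le hθ hx hy _)
      simpa using this
  have hprob : ∀ h : Fin n → ℝ, ∑ σ : Config n,
      (if magnetization S σ = y then gibbsProb (cliqueInteraction θ S) h σ else 0)
      ≤ Real.exp (l * ∑ i ∈ S, siteRatio θ x y (h i)) := fun h => by
    -- A probability bounded by `exp X` is also bounded by `exp (l * X)` for `0 < l ≤ 1`: for `X ≥
    -- 0` it is at most one, and for `X ≤ 0` multiplication by `l` increases the exponent. The small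
    -- parameter needed for the Chernoff bound is thus admissible.
    rcases le_total 0 (∑ i ∈ S, siteRatio θ x y (h i)) with h0 | h0
    · have h1 : ∑ σ : Config n,
          (if magnetization S σ = y then gibbsProb (cliqueInteraction θ S) h σ else 0) ≤ 1 := by
        rw [← sum_gibbsProb (cliqueInteraction θ S) h]
        refine Finset.sum_le_sum fun σ _ => ?_
        split_ifs
        · exact le_rfl
        · exact gibbsProb_nonneg _ _ _
      exact h1.trans (Real.one_le_exp (by positivity))
    · refine (sum_gibbsProb_magnetization_le hθ x y S hS h).trans (Real.exp_le_exp.2 ?_)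
      nlinarith
  rw [cliqueLaw, real_fieldLaw]
  calc ∑ σ, (if magnetization S σ = y then siteProb μ (cliqueInteraction θ S) σ else 0)
      = ∫ h, ∑ σ : Config n, (if magnetization S σ = y then
          gibbsProb (cliqueInteraction θ S) h σ else 0) ∂(Measure.pi fun _ : Fin n => μ) := by
        rw [integral_finsetSum _ fun σ _ => hi σ]
        refine Finset.sum_congr rfl fun σ _ => ?_
        split_ifs
        · rfl
        · simp
    _ ≤ ∫ h, Real.exp (l * ∑ i ∈ S, siteRatio θ x y (h i)) ∂(Measure.pi fun _ : Fin n => μ) :=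
        integral_mono (integrable_finsetSum _ fun σ _ => hi σ) hbd hprob
    _ = (∫ h, Real.exp (l * siteRatio θ x y h) ∂μ) ^ S.card := by
        have h1 : ∀ h : Fin n → ℝ, Real.exp (l * ∑ i ∈ S, siteRatio θ x y (h i))
            = ∏ i, (if i ∈ S then Real.exp (l * siteRatio θ x y (h i)) else 1) := fun h => by
          rw [Finset.mul_sum, Real.exp_sum, Finset.prod_ite_mem, Finset.univ_inter]
        simp_rw [h1]
        rw [integral_fintype_prod_eq_prod
          (f := fun (i : Fin n) z => if i ∈ S then Real.exp (l * siteRatio θ x y z) else 1)]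
        rw [← Finset.prod_const, ← Finset.univ_inter S, ← Finset.prod_ite_mem]
        refine Finset.prod_congr rfl fun i _ => ?_
        by_cases hi : i ∈ S <;> simp [hi]
    _ ≤ Real.exp (-c) ^ S.card :=
        pow_le_pow_left₀ (integral_nonneg fun h => (Real.exp_pos _).le) hc _
    _ = _ := by rw [← Real.exp_nat_mul, mul_comm]

/-- The sum of the spins over `S` takes at most `|S| + 1` values. -/
theorem exists_magnetization_eq {n : ℕ} (S : Finset (Fin n)) (σ : Config n) :
    ∃ j ∈ Finset.range (S.card + 1), magnetization S σ = (2 * j - S.card) / S.card := by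
  refine ⟨(S.filter fun i => σ i = true).card, ?_, ?_⟩
  · rw [Finset.mem_range]
    exact Nat.lt_succ_of_le (Finset.card_filter_le _ _)
  · unfold magnetization
    congr 1
    have : ∀ i, spin (σ i) = 2 * (if σ i = true then 1 else 0) - 1 := fun i => by
      cases σ i <;> simp [spin]; norm_num
    simp_rw [this]
    rw [Finset.sum_sub_distrib, ← Finset.mul_sum, Finset.sum_boole]
    simp

/-- The magnetization on the clique avoids, with exponentially high probability, any set on which
the free energy is bounded away from a value that it attains. -/
theorem cliqueLaw_magnetization_mem_le (hθ : 0 < θ) {x δ : ℝ} (hx : |x| ≤ 1) (hδ : 0 < δ)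
    (A : Set ℝ) (hA : ∀ y ∈ A, freeEnergy μ θ x + δ ≤ freeEnergy μ θ y) :
    ∃ c > 0, ∀ (n : ℕ) (S : Finset (Fin n)), 0 < S.card →
      (cliqueLaw μ θ S).real {σ | magnetization S σ ∈ A}
        ≤ (S.card + 1) * Real.exp (-c * S.card) := by
  obtain ⟨l, hl0, hl1, c, hc, H⟩ := exists_integral_exp_le (μ := μ)
    (show 0 < 3 * θ by positivity) hδ
  refine ⟨c, hc, fun n S hS => ?_⟩
  let v : ℕ → ℝ := fun j => (2 * j - S.card) / S.card
  have hsub : {σ : Config n | magnetization S σ ∈ A}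
      ⊆ ⋃ j ∈ Finset.range (S.card + 1), {σ | magnetization S σ ∈ A ∧ magnetization S σ = v j} := by
    intro σ hσ
    obtain ⟨j, hj, hv⟩ := exists_magnetization_eq S σ
    exact Set.mem_biUnion (x := j) hj ⟨hσ, hv⟩
  refine (measureReal_mono hsub (measure_ne_top _ _)).trans ((measureReal_biUnion_finset_le _ _).trans ?_)
  have : ∀ j ∈ Finset.range (S.card + 1), (cliqueLaw μ θ S).real
      {σ | magnetization S σ ∈ A ∧ magnetization S σ = v j} ≤ Real.exp (-c * S.card) := by
    intro j _
    by_cases h : v j ∈ A ∧ |v j| ≤ 1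
    · refine (measureReal_mono fun σ hσ => hσ.2).trans ?_
      refine cliqueLaw_magnetization_eq_le hθ hl0 hl1 hx h.2 S hS (H _
        (continuous_siteRatio _ _ _) (abs_siteRatio_le hθ hx h.2) ?_)
      rw [integral_siteRatio]
      linarith [hA _ h.1]
    · have : {σ : Config n | magnetization S σ ∈ A ∧ magnetization S σ = v j} = ∅ := by
        refine Set.eq_empty_of_forall_notMem fun σ hσ => h ?_
        rw [← hσ.2]
        exact ⟨hσ.1, abs_magnetization_le S σ⟩
      rw [this, measureReal_empty]
      positivity
  refine (Finset.sum_le_card_nsmul _ _ _ this).trans ?_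
  simp

theorem tendsto_add_one_mul_exp_neg {c : ℝ} (hc : 0 < c) :
    Tendsto (fun k : ℕ => ((k : ℝ) + 1) * Real.exp (-c * k)) atTop (𝓝 0) := by
  have h1 := (Real.tendsto_pow_mul_exp_neg_atTop_nhds_zero 1).comp
    (tendsto_natCast_atTop_atTop.const_mul_atTop hc)
  have h2 := (Real.tendsto_pow_mul_exp_neg_atTop_nhds_zero 0).comp
    (tendsto_natCast_atTop_atTop.const_mul_atTop hc)
  have h3 := (h1.const_mul (1 / c)).add h2
  simp only [mul_zero, add_zero] at h3
  refine h3.congr fun k => ?_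
  simp only [Function.comp_apply, pow_one, pow_zero, one_mul]
  rw [neg_mul]
  field_simp

theorem cliqueLaw_magnetization_mem_small (hθ : 0 < θ) {x δ : ℝ} (hx : |x| ≤ 1) (hδ : 0 < δ)
    (A : Set ℝ) (hA : ∀ y ∈ A, freeEnergy μ θ x + δ ≤ freeEnergy μ θ y) (η : ℝ) (hη : 0 < η) :
    ∃ K : ℕ, ∀ (n : ℕ) (S : Finset (Fin n)), K ≤ S.card →
      (cliqueLaw μ θ S).real {σ | magnetization S σ ∈ A} ≤ η := by
  obtain ⟨c, hc, H⟩ := cliqueLaw_magnetization_mem_le hθ hx hδ A hA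
  obtain ⟨K, hK⟩ := eventually_atTop.1 ((tendsto_add_one_mul_exp_neg hc).eventually
    (ge_mem_nhds hη))
  -- The extra one excludes the empty clique.
  exact ⟨K + 1, fun n S hS => (H n S (by omega)).trans (hK _ (by omega))⟩

end

/-! ### Averages over independent samples -/

/-- Average of `f` over the samples. -/
noncomputable def sampleAvg {n m : ℕ} (f : Config n → ℝ) (X : Fin m → Config n) : ℝ :=
  (∑ j, f (X j)) / m

theorem integral_sample_eval {n m : ℕ} (P : Measure (Config n)) [IsProbabilityMeasure P]
    (f : Config n → ℝ) (j : Fin m) :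
    ∫ X, f (X j) ∂(Measure.pi fun _ : Fin m => P) = ∫ σ, f σ ∂P :=
  integral_comp_eval (μ := fun _ : Fin m => P) (i := j)
    Measurable.of_discrete.aestronglyMeasurable

theorem integral_sampleAvg {n m : ℕ} (hm : 1 ≤ m) (P : Measure (Config n))
    [IsProbabilityMeasure P] (f : Config n → ℝ) :
    ∫ X : Fin m → Config n, sampleAvg f X ∂(Measure.pi fun _ => P) = ∫ σ, f σ ∂P := by
  have hm' : (m : ℝ) ≠ 0 := by positivity
  unfold sampleAvg
  rw [integral_div, integral_finsetSum _ fun j _ => .of_finite]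
  simp_rw [integral_sample_eval]
  simp only [Finset.sum_const, Finset.card_univ, Fintype.card_fin, nsmul_eq_mul]
  field_simp

theorem sampleAvg_nonneg {n m : ℕ} {f : Config n → ℝ} (hf : ∀ σ, 0 ≤ f σ)
    (X : Fin m → Config n) : 0 ≤ sampleAvg f X :=
  div_nonneg (Finset.sum_nonneg fun _ _ => hf _) (Nat.cast_nonneg _)

theorem real_le_sampleAvg_le {n m : ℕ} (hm : 1 ≤ m) (P : Measure (Config n))
    [IsProbabilityMeasure P] {f : Config n → ℝ} (hf : ∀ σ, 0 ≤ f σ) {τ : ℝ} (hτ : 0 < τ) :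
    (Measure.pi fun _ : Fin m => P).real {X | τ ≤ sampleAvg f X} ≤ (∫ σ, f σ ∂P) / τ := by
  rw [le_div_iff₀ hτ, mul_comm, ← integral_sampleAvg hm P f]
  exact mul_meas_ge_le_integral_of_nonneg (Eventually.of_forall fun X => sampleAvg_nonneg hf X)
    .of_finite τ

/-- If the average is below `τ`, a fraction at least `1 - τ / τ'` of the samples has `f < τ'`.
Markov's inequality for that fraction gives a bound independent of the number of samples, so a
single sample is already covered. -/
theorem real_sampleAvg_lt_le {n m : ℕ} (hm : 1 ≤ m) (P : Measure (Config n))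
    [IsProbabilityMeasure P] {f : Config n → ℝ} (hf : ∀ σ, 0 ≤ f σ) {τ τ' : ℝ} (hτ : 0 < τ)
    (hττ' : τ < τ') :
    (Measure.pi fun _ : Fin m => P).real {X | sampleAvg f X < τ}
      ≤ P.real {σ | f σ < τ'} / (1 - τ / τ') := by
  classical
  have hτ' : 0 < τ' := hτ.trans hττ'
  have hpos : 0 < 1 - τ / τ' := by rw [sub_pos, div_lt_one hτ']; exact hττ'
  let g : Config n → ℝ := Set.indicator {σ | f σ < τ'} 1
  have hg : ∀ σ, 0 ≤ g σ := fun σ => Set.indicator_nonneg (fun _ _ => zero_le_one) σ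
  have h := real_le_sampleAvg_le hm P hg hpos
  rw [integral_indicator_one (Set.toFinite _).measurableSet] at h
  refine (measureReal_mono fun X hX => ?_).trans h
  have hm' : (0 : ℝ) < m := by exact_mod_cast hm
  have h1 : ∀ σ, τ' * (1 - g σ) ≤ f σ := fun σ => by
    by_cases hσ : f σ < τ'
    · have : g σ = 1 := by simp [g, hσ]
      rw [this]; simpa using hf σ
    · have : g σ = 0 := by simp [g, hσ]
      rw [this]; simpa using not_lt.1 hσ
  have h2 : τ' * (1 - sampleAvg g X) ≤ sampleAvg f X := by
    unfold sampleAvg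
    rw [le_div_iff₀ hm']
    calc τ' * (1 - (∑ j, g (X j)) / m) * m = ∑ j : Fin m, τ' * (1 - g (X j)) := by
          rw [← Finset.mul_sum, Finset.sum_sub_distrib]
          simp only [Finset.sum_const, Finset.card_univ, Fintype.card_fin, nsmul_eq_mul]
          field_simp
      _ ≤ _ := Finset.sum_le_sum fun j _ => h1 _
  have h3 : sampleAvg f X < τ := hX
  change 1 - τ / τ' ≤ sampleAvg g X
  rw [sub_le_comm, le_div_iff₀ hτ']
  linarith

theorem real_abs_sampleAvg_sub_le {n m : ℕ} (hm : 1 ≤ m) (P : Measure (Config n))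
    [IsProbabilityMeasure P] (f : Config n → ℝ) {ε V : ℝ} (hε : 0 < ε)
    (hV : ∫ σ, f σ ^ 2 ∂P ≤ V) :
    (Measure.pi fun _ : Fin m => P).real {X | ε ≤ |sampleAvg f X - ∫ σ, f σ ∂P|}
      ≤ V / (m * ε ^ 2) := by
  have hm' : (0 : ℝ) < m := by exact_mod_cast hm
  have hL : MemLp f 2 P := .of_discrete
  have hvar : Var[fun X : Fin m → Config n => sampleAvg f X; Measure.pi fun _ => P]
      ≤ V / m := by
    have h1 := variance_sum_pi (μ := fun _ : Fin m => P) (X := fun _ => f) fun _ => hL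
    have h2 : (fun X : Fin m → Config n => sampleAvg f X)
        = fun X => (1 / (m : ℝ)) * (∑ i : Fin m, fun ω : Fin m → Config n => f (ω i)) X := by
      funext X
      simp only [sampleAvg, Finset.sum_apply]
      ring
    rw [h2, variance_const_mul, h1]
    simp only [Finset.sum_const, Finset.card_univ, Fintype.card_fin, nsmul_eq_mul]
    have h3 : Var[f; P] ≤ V := (variance_le_expectation_sq hL.1).trans hV
    calc (1 / (m : ℝ)) ^ 2 * (m * Var[f; P]) = Var[f; P] / m := by field_simp
      _ ≤ _ := by gcongr
  have h := meas_ge_le_variance_div_sq (μ := Measure.pi fun _ : Fin m => P)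
    (X := fun X : Fin m → Config n => sampleAvg f X) .of_discrete hε
  rw [integral_sampleAvg hm] at h
  have h' := ENNReal.toReal_le_of_le_ofReal
    (div_nonneg (variance_nonneg _ _) (sq_nonneg ε)) h
  refine (show _ ≤ _ from h').trans ?_
  rw [← div_div]
  gcongr

/-! ### Absolute moments through characteristic functions -/

/-- Adding the two bounds on `d`, the first multiplied by `t ^ 2`, gives `d * (1 + t ^ 2) ≤ 3 * q *
t ^ 2`. This provides an integrable majorant that handles both the singularity at zero and the tail.
-/
theorem div_sq_le {d t q : ℝ} (hd : d ≤ 2 * q) (hdt : d ≤ t ^ 2 * q) :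
    d / t ^ 2 ≤ q * (3 * (1 + t ^ 2)⁻¹) ∨ t = 0 := by
  by_cases ht : t = 0
  · exact Or.inr ht
  left
  have h0 : 0 < t ^ 2 := by positivity
  rw [← div_eq_mul_inv, ← mul_div_assoc, div_le_div_iff₀ h0 (by positivity)]
  nlinarith

theorem integrable_sq_bound : Integrable fun t : ℝ => 3 * (1 + t ^ 2)⁻¹ :=
  integrable_inv_one_add_sq.const_mul 3

/-- The constant `∫₀^∞ (1 - cos t) / t² dt`. -/
noncomputable def cosConst : ℝ := ∫ t in Set.Ioi (0 : ℝ), (1 - Real.cos t) / t ^ 2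

theorem one_sub_cos_div_sq_le (a t : ℝ) :
    ‖(1 - Real.cos (t * a)) / t ^ 2‖ ≤ (1 + a ^ 2) * (3 * (1 + t ^ 2)⁻¹) := by
  have h0 : 0 ≤ 1 - Real.cos (t * a) := by linarith [Real.cos_le_one (t * a)]
  rw [Real.norm_of_nonneg (by positivity)]
  have h1 := Real.neg_one_le_cos (t * a)
  have h2 := Real.one_sub_sq_div_two_le_cos (x := t * a)
  rcases div_sq_le (d := 1 - Real.cos (t * a)) (t := t) (q := 1 + a ^ 2) (by nlinarith)
    (by nlinarith [sq_nonneg t, mul_nonneg (sq_nonneg t) (sq_nonneg a)]) with h | h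
  · exact h
  · subst h; simp; positivity

theorem integrable_one_sub_cos_div_sq (a : ℝ) :
    Integrable fun t : ℝ => (1 - Real.cos (t * a)) / t ^ 2 :=
  (integrable_sq_bound.const_mul (1 + a ^ 2)).mono'
    (by fun_prop : Measurable fun t : ℝ => (1 - Real.cos (t * a)) / t ^ 2).aestronglyMeasurable
    (Eventually.of_forall (one_sub_cos_div_sq_le a))

theorem cosConst_pos : 0 < cosConst := by
  have hi : Integrable fun t : ℝ => (1 - Real.cos t) / t ^ 2 := by
    simpa using integrable_one_sub_cos_div_sq 1
  unfold cosConst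
  rw [setIntegral_pos_iff_support_of_nonneg_ae (Eventually.of_forall fun t => ?_) hi.integrableOn]
  · have hsub : Set.Ioo (0 : ℝ) 1
        ⊆ (Function.support fun t : ℝ => (1 - Real.cos t) / t ^ 2) ∩ Set.Ioi 0 := by
      intro t ht
      refine ⟨?_, ht.1⟩
      have h1 : Real.cos t < Real.cos 0 :=
        Real.cos_lt_cos_of_nonneg_of_le_pi le_rfl (by linarith [ht.2, Real.pi_gt_three]) ht.1
      rw [Real.cos_zero] at h1
      have h2 := ht.1
      have : 0 < (1 - Real.cos t) / t ^ 2 := div_pos (by linarith) (by positivity)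
      exact this.ne'
    refine lt_of_lt_of_le ?_ (measure_mono hsub)
    simp
  · have : 0 ≤ 1 - Real.cos t := by linarith [Real.cos_le_one t]
    change 0 ≤ (1 - Real.cos t) / t ^ 2
    positivity

/-- The substitution `t ↦ b * t` extracts the scale. Only the positivity of `cosConst` is needed
later, not its value. -/
theorem integral_one_sub_cos_div_sq (a : ℝ) :
    ∫ t in Set.Ioi (0 : ℝ), (1 - Real.cos (t * a)) / t ^ 2 = cosConst * |a| := by
  have key : ∀ b : ℝ, 0 < b →
      ∫ t in Set.Ioi (0 : ℝ), (1 - Real.cos (t * b)) / t ^ 2 = cosConst * b := by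
    intro b hb
    have h := integral_comp_mul_left_Ioi (fun t : ℝ => (1 - Real.cos t) / t ^ 2) 0 hb
    have h2 : ∀ t : ℝ, (1 - Real.cos (t * b)) / t ^ 2
        = b ^ 2 * ((1 - Real.cos (b * t)) / (b * t) ^ 2) := fun t => by
      rw [mul_comm t b, mul_pow, ← mul_div_assoc, mul_div_mul_left _ _ (by positivity)]
    simp_rw [h2]
    rw [integral_const_mul, h, mul_zero, smul_eq_mul]
    unfold cosConst
    field_simp
  rcases lt_trichotomy a 0 with ha | rfl | ha
  · rw [abs_of_neg ha, ← key (-a) (by linarith)]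
    simp
  · simp
  · rw [abs_of_pos ha, key a ha]

section

variable {Ω Ω' : Type*} [MeasurableSpace Ω] [MeasurableSpace Ω'] {P : Measure Ω} {P' : Measure Ω'}
  [IsProbabilityMeasure P] [IsProbabilityMeasure P']

/-- Fubini applied to the integral representation of `|a|`. The second moment provides the product
majorant `(1 + f²) * 3 / (1 + t²)`. -/
theorem integral_abs_eq_integral_cos {f : Ω → ℝ} (hf : Measurable f)
    (hf2 : Integrable (fun ω => f ω ^ 2) P) :
    IntegrableOn (fun t => (1 - ∫ ω, Real.cos (t * f ω) ∂P) / t ^ 2) (Set.Ioi 0) ∧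
    ∫ t in Set.Ioi (0 : ℝ), (1 - ∫ ω, Real.cos (t * f ω) ∂P) / t ^ 2
      = cosConst * ∫ ω, |f ω| ∂P := by
  have hcos : ∀ t : ℝ, Integrable (fun ω => Real.cos (t * f ω)) P := fun t =>
    Integrable.of_bound (C := 1) (by fun_prop : Measurable _).aestronglyMeasurable
      (Eventually.of_forall fun ω => Real.abs_cos_le_one _)
  have hprod : Integrable (Function.uncurry fun (ω : Ω) (t : ℝ) =>
      (1 - Real.cos (t * f ω)) / t ^ 2) (P.prod (volume.restrict (Set.Ioi 0))) := by
    refine Integrable.mono' (((integrable_const (1 : ℝ)).add hf2).mul_prod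
      (integrable_sq_bound.integrableOn (s := Set.Ioi 0))) ?_
      (Eventually.of_forall fun p => one_sub_cos_div_sq_le (f p.1) p.2)
    refine Measurable.aestronglyMeasurable ?_
    unfold Function.uncurry
    fun_prop
  have heq : ∀ t : ℝ, ∫ ω, (1 - Real.cos (t * f ω)) / t ^ 2 ∂P
      = (1 - ∫ ω, Real.cos (t * f ω) ∂P) / t ^ 2 := fun t => by
    rw [integral_div, integral_sub (integrable_const _) (hcos t)]
    simp
  constructor
  · have := hprod.integral_prod_right
    simp only [Function.uncurry] at this
    simp_rw [heq] at this
    exact this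
  · simp_rw [← heq]
    rw [← integral_integral_swap hprod]
    simp_rw [integral_one_sub_cos_div_sq]
    rw [integral_const_mul]

/-- Comparison of absolute moments of two random variables with symmetric laws, uniformly over
shifts. -/
theorem abs_integral_abs_add_sub_le {f : Ω → ℝ} {g : Ω' → ℝ} (hf : Measurable f)
    (hg : Measurable g) (hf2 : MemLp f 2 P) (hg2 : MemLp g 2 P')
    {φ ψ : ℝ → ℝ} (hφ : ∀ a t, ∫ ω, Real.cos (a + t * f ω) ∂P = Real.cos a * φ t)
    (hψ : ∀ a t, ∫ ω, Real.cos (a + t * g ω) ∂P' = Real.cos a * ψ t) (y : ℝ) :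
    |∫ ω, |y + f ω| ∂P - ∫ ω, |y + g ω| ∂P'|
      ≤ cosConst⁻¹ * ∫ t in Set.Ioi (0 : ℝ), |φ t - ψ t| / t ^ 2 := by
  have key : ∀ a : ℝ,
      IntegrableOn (fun t => (1 - Real.cos (t * a) * φ t) / t ^ 2) (Set.Ioi 0) ∧
      ∫ t in Set.Ioi (0 : ℝ), (1 - Real.cos (t * a) * φ t) / t ^ 2
        = cosConst * ∫ ω, |a + f ω| ∂P := fun a => by
    have := integral_abs_eq_integral_cos (P := P) (f := fun ω => a + f ω) (by fun_prop)
      ((memLp_const a).add hf2).integrable_sq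
    simpa only [mul_add, hφ] using this
  have key' : ∀ a : ℝ,
      IntegrableOn (fun t => (1 - Real.cos (t * a) * ψ t) / t ^ 2) (Set.Ioi 0) ∧
      ∫ t in Set.Ioi (0 : ℝ), (1 - Real.cos (t * a) * ψ t) / t ^ 2
        = cosConst * ∫ ω, |a + g ω| ∂P' := fun a => by
    have := integral_abs_eq_integral_cos (P := P') (f := fun ω => a + g ω) (by fun_prop)
      ((memLp_const a).add hg2).integrable_sq
    simpa only [mul_add, hψ] using this
  -- At shift zero the cosine factor is one, so this is the absolute difference of two integrands
  -- already known to be integrable.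
  have hint : IntegrableOn (fun t => |φ t - ψ t| / t ^ 2) (Set.Ioi 0) := by
    have := ((key' 0).1.sub (key 0).1).abs
    refine this.congr (Eventually.of_forall fun t => ?_)
    simp only [Pi.sub_apply, mul_zero, Real.cos_zero, one_mul]
    rw [← sub_div, abs_div, abs_of_nonneg (sq_nonneg t)]
    congr 2
    ring
  rw [← div_eq_inv_mul, le_div_iff₀ cosConst_pos, ← abs_of_pos cosConst_pos, ← abs_mul,
    mul_comm, mul_sub, ← (key y).2, ← (key' y).2,
    ← integral_sub (key y).1 (key' y).1, ← Real.norm_eq_abs]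
  -- The shift survives only in the factor `cos (t * y)`, of modulus at most one; hence the bound is
  -- uniform in `y`.
  refine norm_integral_le_of_norm_le hint (Eventually.of_forall fun t => ?_)
  rw [← sub_div, norm_div, Real.norm_of_nonneg (sq_nonneg t)]
  refine div_le_div_of_nonneg_right ?_ (sq_nonneg t)
  rw [show 1 - Real.cos (t * y) * φ t - (1 - Real.cos (t * y) * ψ t)
    = - (Real.cos (t * y) * (φ t - ψ t)) by ring, norm_neg, norm_mul]
  exact mul_le_of_le_one_left (abs_nonneg _) (Real.abs_cos_le_one _)

end

/-! ### Gaussian approximation of sums of uniform spins -/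

/-- For `|u| ≤ 1`, `cos u` and `exp (-u² / 2)` agree up to `u ^ 4`. Both have modulus at most one,
so passing to `N`-th powers costs a factor at most `N`. -/
theorem abs_cos_pow_sub_exp_le {u : ℝ} (hu : |u| ≤ 1) (N : ℕ) :
    |Real.cos u ^ N - Real.exp (-(N * u ^ 2 / 2))| ≤ N * u ^ 4 := by
  have h1 := Real.cos_bound hu
  have hu2 : u ^ 2 ≤ 1 := (sq_le_one_iff_abs_le_one u).2 hu
  have h2 := Real.abs_exp_sub_one_sub_id_le (x := -(u ^ 2 / 2))
    (by rw [abs_neg, abs_of_nonneg (by positivity)]; linarith)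
  have h3 : |Real.cos u - Real.exp (-(u ^ 2 / 2))| ≤ u ^ 4 := by
    have h4 : |u| ^ 4 = u ^ 4 := by rw [← abs_pow]; exact abs_of_nonneg (by positivity)
    rw [h4] at h1
    rw [abs_le] at h1 h2 ⊢
    have : 0 ≤ u ^ 4 := by positivity
    constructor <;> nlinarith
  have h5 := abs_pow_sub_pow_le (Real.cos u) (Real.exp (-(u ^ 2 / 2))) N
  rw [← Real.exp_nat_mul, show (N : ℝ) * -(u ^ 2 / 2) = -(N * u ^ 2 / 2) by ring] at h5
  refine h5.trans ?_
  have h6 : max |Real.cos u| |Real.exp (-(u ^ 2 / 2))| ^ (N - 1) ≤ 1 := by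
    refine pow_le_one₀ (le_max_of_le_left (abs_nonneg _)) (max_le (Real.abs_cos_le_one u) ?_)
    rw [abs_of_pos (Real.exp_pos _), Real.exp_le_one_iff]
    linarith [sq_nonneg u]
  calc _ ≤ |Real.cos u - Real.exp (-(u ^ 2 / 2))| * N * 1 := by gcongr
    _ ≤ u ^ 4 * N * 1 := by gcongr
    _ = _ := by ring

/-- Uniform bound, over shifts, for the distance between the absolute moments of a normalized sum
of `n` uniform spins and of a standard Gaussian. -/
noncomputable def absMomentDist (n : ℕ) : ℝ :=
  cosConst⁻¹ * ∫ t in Set.Ioi (0 : ℝ), |Real.cos (t / √n) ^ n - Real.exp (-(t ^ 2 / 2))| / t ^ 2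

/-- Both functions lie between `1 - t² / 2` and `1`, by Bernoulli's inequality for the cosine power.
The bound is uniform in `n` and controls the singularity of `1 / t²` in the dominated convergence
argument. -/
theorem abs_cos_pow_sub_exp_le_sq (n : ℕ) (t : ℝ) :
    |Real.cos (t / √n) ^ n - Real.exp (-(t ^ 2 / 2))| ≤ t ^ 2 := by
  have h1 : 1 - t ^ 2 / 2 ≤ Real.cos (t / √n) ^ n := by
    have h := one_add_mul_le_pow (a := Real.cos (t / √n) - 1)
      (by linarith [Real.neg_one_le_cos (t / √n)]) n
    have h2 := Real.one_sub_sq_div_two_le_cos (x := t / √n)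
    rw [add_sub_cancel] at h
    refine le_trans ?_ h
    have h3 : (n : ℝ) * (t / √n) ^ 2 ≤ t ^ 2 := by
      rw [div_pow, Real.sq_sqrt (Nat.cast_nonneg n)]
      rcases Nat.eq_zero_or_pos n with rfl | hn
      · simp; positivity
      · field_simp; rfl
    have h4 : (n : ℝ) * (1 - (t / √n) ^ 2 / 2 - 1) ≤ n * (Real.cos (t / √n) - 1) := by gcongr
    linarith
  have h2 : Real.cos (t / √n) ^ n ≤ 1 := by
    refine (le_abs_self _).trans ?_
    rw [abs_pow]
    exact pow_le_one₀ (abs_nonneg _) (Real.abs_cos_le_one _)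
  have h3 := Real.add_one_le_exp (-(t ^ 2 / 2))
  have h4 : Real.exp (-(t ^ 2 / 2)) ≤ 1 := by
    rw [Real.exp_le_one_iff]; linarith [sq_nonneg t]
  rw [abs_le]
  constructor <;> nlinarith [sq_nonneg t]

theorem tendsto_absMomentDist : Tendsto absMomentDist atTop (𝓝 0) := by
  have h : Tendsto (fun n : ℕ => ∫ t in Set.Ioi (0 : ℝ),
      |Real.cos (t / √n) ^ n - Real.exp (-(t ^ 2 / 2))| / t ^ 2) atTop
      (𝓝 (∫ _ in Set.Ioi (0 : ℝ), (0 : ℝ))) := by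
    refine tendsto_integral_of_dominated_convergence (fun t => 3 * (1 + t ^ 2)⁻¹)
      (fun n => ?_) integrable_sq_bound.integrableOn (fun n => Eventually.of_forall fun t => ?_)
      (Eventually.of_forall fun t => ?_)
    · exact (by fun_prop : Measurable _).aestronglyMeasurable
    · rw [Real.norm_of_nonneg (by positivity)]
      have h1 := abs_cos_pow_sub_exp_le_sq n t
      have h2 : |Real.cos (t / √n) ^ n - Real.exp (-(t ^ 2 / 2))| ≤ 2 := by
        refine (abs_sub _ _).trans ?_
        have a : |Real.cos (t / √n) ^ n| ≤ 1 := by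
          rw [abs_pow]; exact pow_le_one₀ (abs_nonneg _) (Real.abs_cos_le_one _)
        have b : |Real.exp (-(t ^ 2 / 2))| ≤ 1 := by
          rw [abs_of_pos (Real.exp_pos _), Real.exp_le_one_iff]; linarith [sq_nonneg t]
        linarith
      rcases div_sq_le (d := |Real.cos (t / √n) ^ n - Real.exp (-(t ^ 2 / 2))|) (t := t) (q := 1)
        (by linarith) (by linarith) with h | h
      · simpa using h
      · subst h; simp
    · have hn : Tendsto (fun n : ℕ => (n : ℝ)) atTop atTop := tendsto_natCast_atTop_atTop
      have h0 : Tendsto (fun n : ℕ => t ^ 4 / (n : ℝ)) atTop (𝓝 0) :=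
        tendsto_const_nhds.div_atTop hn
      have h1 : Tendsto (fun n : ℕ => |Real.cos (t / √n) ^ n - Real.exp (-(t ^ 2 / 2))|) atTop
          (𝓝 0) := by
        refine squeeze_zero' (Eventually.of_forall fun n => abs_nonneg _) ?_ h0
        filter_upwards [hn.eventually_ge_atTop (t ^ 2), hn.eventually_gt_atTop 0] with n h2 h3
        have h4 : (t / √n) ^ 2 = t ^ 2 / n := by rw [div_pow, Real.sq_sqrt h3.le]
        have h5 : |t / √n| ≤ 1 := by
          rw [← sq_le_one_iff_abs_le_one, h4, div_le_one h3]; exact h2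
        have h6 := abs_cos_pow_sub_exp_le h5 n
        rw [show (t / √n) ^ 4 = ((t / √n) ^ 2) ^ 2 by ring, h4] at h6
        convert! h6 using 1
        · congr 3; field_simp
        · field_simp
      simpa using h1.div_const (t ^ 2)
  have := h.const_mul cosConst⁻¹
  rwa [integral_zero, mul_zero] at this

theorem integral_cos_gaussian (a t : ℝ) :
    ∫ z, Real.cos (a + t * z) ∂(gaussianReal 0 1) = Real.cos a * Real.exp (-(t ^ 2 / 2)) := by
  have h := charFun_gaussianReal (μ := 0) (v := 1) t
  rw [charFun_apply_real] at h
  have hre : ∀ z : ℝ, Real.cos (a + t * z)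
      = RCLike.re (Complex.exp (a * Complex.I) * Complex.exp (t * z * Complex.I)) := fun z => by
    rw [← Complex.exp_add, ← add_mul, ← Complex.ofReal_mul, ← Complex.ofReal_add]
    exact (Complex.exp_ofReal_mul_I_re _).symm
  have hi : Integrable (fun z : ℝ => Complex.exp (a * Complex.I) * Complex.exp (t * z * Complex.I))
      (gaussianReal 0 1) := by
    refine Integrable.of_bound (C := 1) (by fun_prop : Measurable _).aestronglyMeasurable
      (Eventually.of_forall fun z => ?_)
    rw [← Complex.exp_add, ← add_mul, ← Complex.ofReal_mul, ← Complex.ofReal_add,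
      Complex.norm_exp_ofReal_mul_I]
  simp_rw [hre]
  rw [integral_re hi, integral_const_mul, h]
  have : ((t : ℂ) * (0 : ℝ) * Complex.I - ((1 : ℝ≥0) : ℝ) * (t : ℂ) ^ 2 / 2)
      = ((-(t ^ 2 / 2) : ℝ) : ℂ) := by push_cast; ring
  rw [this, ← Complex.ofReal_exp]
  simp only [RCLike.re_eq_complex_re]
  rw [Complex.re_mul_ofReal, Complex.exp_ofReal_mul_I_re]

/-- `E |y + s Z|` for a standard Gaussian `Z`. -/
noncomputable def meanAbs (y s : ℝ) : ℝ := ∫ z, |y + s * z| ∂(gaussianReal 0 1)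

theorem memLp_gaussian : MemLp (fun z : ℝ => z) 2 (gaussianReal 0 1) :=
  memLp_id_gaussianReal 2

theorem integrable_gaussian : Integrable (fun z : ℝ => z) (gaussianReal 0 1) :=
  memLp_gaussian.integrable one_le_two

theorem abs_integral_nullLaw_sub_meanAbs_le {n : ℕ} (μ : Measure ℝ)
    [IsProbabilityMeasure μ] (hsymm : μ.map (fun h => -h) = μ) (y : ℝ) :
    |∫ σ, |y + (∑ i, spin (σ i)) / √n| ∂(nullLaw n μ) - meanAbs y 1| ≤ absMomentDist n := by
  have h := abs_integral_abs_add_sub_le (P := nullLaw n μ) (P' := gaussianReal 0 1)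
    (f := fun σ => (∑ i, spin (σ i)) / √n) (g := fun z => z) (φ := fun t => Real.cos (t / √n) ^ n)
    (ψ := fun t => Real.exp (-(t ^ 2 / 2))) Measurable.of_discrete measurable_id .of_discrete
    memLp_gaussian (fun a t => ?_) integral_cos_gaussian y
  · simpa [meanAbs, absMomentDist] using h
  · have := integral_nullLaw_cos μ hsymm (Finset.univ : Finset (Fin n)) (t / √n) a
    rw [Finset.card_univ, Fintype.card_fin] at this
    rw [← this]
    congr 1
    funext σ
    rw [div_mul_eq_mul_div, mul_div_assoc]

/-! ### Absolute moments of the Gaussian law -/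

theorem integrable_abs_gaussian (y s : ℝ) :
    Integrable (fun z : ℝ => |y + s * z|) (gaussianReal 0 1) :=
  ((integrable_const y).add (integrable_gaussian.const_mul s)).abs

theorem integral_sq_gaussian : ∫ z, z ^ 2 ∂(gaussianReal 0 1) = 1 := by
  have h := variance_eq_sub memLp_gaussian
  rw [variance_fun_id_gaussianReal] at h
  simpa using h.symm

theorem integral_abs_gaussian_le : ∫ z, |z| ∂(gaussianReal 0 1) ≤ 1 := by
  have h : ∫ z : ℝ, |z| ∂(gaussianReal 0 1) ≤ ∫ z : ℝ, (1 + z ^ 2) / 2 ∂(gaussianReal 0 1) := by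
    refine integral_mono integrable_gaussian.abs
      (((integrable_const 1).add memLp_gaussian.integrable_sq).div_const 2) fun z => ?_
    have := sq_abs z
    simp only
    nlinarith [sq_nonneg (|z| - 1)]
  rw [integral_div, integral_add (integrable_const _) memLp_gaussian.integrable_sq,
    integral_sq_gaussian] at h
  simpa using h

theorem max_abs_abs_eq (a b : ℝ) : max |a| |b| = (|a + b| + |a - b|) / 2 := by
  rcases le_total 0 a with ha | ha <;> rcases le_total 0 b with hb | hb <;>
  rcases le_total 0 (a + b) with hab | hab <;> rcases le_total 0 (a - b) with hab' | hab' <;>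
  rcases le_total |a| |b| with h | h <;>
  simp only [max_eq_left h, max_eq_right h] <;>
  simp only [abs_of_nonneg, abs_of_nonpos, ha, hb, hab, hab'] at h ⊢ <;> linarith

/-- Averaging over `z` and `-z` replaces the absolute value by a maximum, from which evenness and
monotonicity in `|y|` can be read off. -/
theorem meanAbs_eq_max (y s : ℝ) :
    meanAbs y s = ∫ z, max |y| |s * z| ∂(gaussianReal 0 1) := by
  have h : meanAbs y s = ∫ z, |y - s * z| ∂(gaussianReal 0 1) := by
    unfold meanAbs
    have hm : (gaussianReal 0 1).map (fun x => -x) = gaussianReal 0 1 := by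
      rw [gaussianReal_map_neg, neg_zero]
    conv_lhs => rw [← hm]
    rw [integral_map (by fun_prop) (by fun_prop : Continuous _).aestronglyMeasurable]
    simp [sub_eq_add_neg]
  simp_rw [max_abs_abs_eq]
  have hi : Integrable (fun z : ℝ => |y - s * z|) (gaussianReal 0 1) := by
    simpa [sub_eq_add_neg] using integrable_abs_gaussian y (-s)
  rw [integral_div, integral_add (integrable_abs_gaussian y s) hi, ← h]
  unfold meanAbs
  ring

theorem meanAbs_abs (y s : ℝ) : meanAbs |y| s = meanAbs y s := by
  simp [meanAbs_eq_max]

theorem integrable_max_gaussian (y s : ℝ) :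
    Integrable (fun z : ℝ => max |y| |s * z|) (gaussianReal 0 1) :=
  (integrable_const |y|).sup (integrable_gaussian.const_mul s).abs

theorem meanAbs_mono {y y' : ℝ} (h : |y| ≤ |y'|) (s : ℝ) : meanAbs y s ≤ meanAbs y' s := by
  rw [meanAbs_eq_max, meanAbs_eq_max]
  exact integral_mono (integrable_max_gaussian y s) (integrable_max_gaussian y' s)
    fun z => max_le_max_right _ h

theorem meanAbs_sub_le (y y' s s' : ℝ) :
    meanAbs y s - meanAbs y' s' ≤ |y - y'| + |s - s'| := by
  unfold meanAbs
  rw [← integral_sub (integrable_abs_gaussian y s) (integrable_abs_gaussian y' s')]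
  calc ∫ z, (|y + s * z| - |y' + s' * z|) ∂(gaussianReal 0 1)
      ≤ ∫ z, (|y - y'| + |s - s'| * |z|) ∂(gaussianReal 0 1) := by
        refine integral_mono ((integrable_abs_gaussian y s).sub (integrable_abs_gaussian y' s'))
          ((integrable_const _).add (integrable_gaussian.abs.const_mul _)) fun z => ?_
        refine (abs_sub_abs_le_abs_sub _ _).trans ?_
        rw [← abs_mul, show y + s * z - (y' + s' * z) = (y - y') + (s - s') * z by ring]
        exact abs_add_le _ _
    _ = |y - y'| + |s - s'| * ∫ z, |z| ∂(gaussianReal 0 1) := by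
        rw [integral_add (integrable_const _) (integrable_gaussian.abs.const_mul _),
          integral_const_mul]
        simp
    _ ≤ _ := by
        have := mul_le_mul_of_nonneg_left integral_abs_gaussian_le (abs_nonneg (s - s'))
        linarith

theorem abs_meanAbs_sub_le (y y' s s' : ℝ) :
    |meanAbs y s - meanAbs y' s'| ≤ |y - y'| + |s - s'| := by
  rw [abs_le]
  have h1 := meanAbs_sub_le y y' s s'
  have h2 := meanAbs_sub_le y' y s' s
  rw [abs_sub_comm y', abs_sub_comm s'] at h2
  constructor <;> linarith

theorem meanAbs_mul {c : ℝ} (hc : 0 ≤ c) (y s : ℝ) :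
    meanAbs (c * y) (c * s) = c * meanAbs y s := by
  unfold meanAbs
  rw [← integral_const_mul]
  congr 1
  funext z
  rw [mul_assoc, ← mul_add, abs_mul, abs_of_nonneg hc]

/-- Uniform gap between the absolute moments of `N(x, s²)` and of `N(0, s²)`. -/
theorem exists_meanAbs_gap {x s₀ : ℝ} (hx : 0 < x) (hs₀ : 0 < s₀) :
    ∃ γ > 0, ∀ s, 0 ≤ s → s ≤ s₀ → meanAbs 0 s + γ ≤ meanAbs x s := by
  -- For `0 ≤ s ≤ s₀`, replacing `0` by `x` increases `max |y| |s * z|` by the positive part of `x -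
  -- s * |z|`, which is at least `f z`. The Gaussian mean of `f` is a gap independent of `s`,
  -- positive because `f` is positive on a nonempty open set.
  let f : ℝ → ℝ := fun z => max (x - s₀ * |z|) 0
  have hfc : Continuous f := by fun_prop
  have hfi : Integrable f (gaussianReal 0 1) := by
    refine Integrable.of_bound (C := x) hfc.aestronglyMeasurable (Eventually.of_forall fun z => ?_)
    rw [Real.norm_of_nonneg (le_max_right _ _)]
    exact max_le (by have := abs_nonneg z; nlinarith) hx.le
  refine ⟨∫ z, f z ∂(gaussianReal 0 1), ?_, fun s h0 hs => ?_⟩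
  · rw [gt_iff_lt, integral_pos_iff_support_of_nonneg (f := f) (fun z => le_max_right _ _) hfi]
    have hopen : IsOpen (Function.support f) := hfc.isOpen_support
    have hne : (Function.support f).Nonempty := ⟨0, by
      simp only [f, Function.mem_support, abs_zero, mul_zero, sub_zero, max_eq_left hx.le]
      exact hx.ne'⟩
    rw [pos_iff_ne_zero]
    intro h
    exact (hopen.measure_pos volume hne).ne'
      (gaussianReal_absolutelyContinuous' 0 one_ne_zero h)
  · rw [meanAbs_eq_max, meanAbs_eq_max, ← integral_add (integrable_max_gaussian 0 s) hfi]
    refine integral_mono ((integrable_max_gaussian 0 s).add hfi) (integrable_max_gaussian x s)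
      fun z => ?_
    simp only [f, abs_zero, abs_of_pos hx, abs_mul, abs_of_nonneg h0]
    have h1 : s * |z| ≤ s₀ * |z| := by gcongr
    rw [max_eq_right (show 0 ≤ s * |z| by positivity), ← max_add_add_left, add_zero]
    exact max_le_max (by linarith) le_rfl

/-- The Gaussian density satisfies `p' z = -z * p z`, so `-p` is an antiderivative vanishing at
`-∞`. -/
theorem setIntegral_Iic_gaussian (c : ℝ) :
    ∫ z in Set.Iic c, z ∂(gaussianReal 0 1) = -gaussianPDFReal 0 1 c := by
  have hpdf : ∀ z, gaussianPDFReal 0 1 z = (√(2 * Real.pi))⁻¹ * Real.exp (-(1 / 2) * z ^ 2) :=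
    fun z => by
      rw [gaussianPDFReal]
      simp only [NNReal.coe_one, mul_one, sub_zero]
      congr 2
      ring
  rw [← integral_indicator measurableSet_Iic, integral_gaussianReal_eq_integral_smul one_ne_zero]
  have h1 : ∀ z, gaussianPDFReal 0 1 z • (Set.Iic c).indicator (fun z => z) z
      = (Set.Iic c).indicator (fun z => gaussianPDFReal 0 1 z * z) z := fun z => by
    simp [Set.indicator_apply]
  simp_rw [h1]
  rw [integral_indicator measurableSet_Iic]
  have hder : ∀ z ∈ Set.Iic c, HasDerivAt (fun z => -gaussianPDFReal 0 1 z)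
      (gaussianPDFReal 0 1 z * z) z := fun z _ => by
    have h2 : HasDerivAt (fun z : ℝ => -(1 / 2) * z ^ 2) (-z) z := by
      have := (hasDerivAt_pow 2 z).const_mul (-(1 / 2) : ℝ)
      convert! this using 1
      simp
    have h3 := (h2.exp.const_mul ((√(2 * Real.pi))⁻¹)).neg
    simp_rw [hpdf]
    convert! h3 using 1
    ring
  rw [integral_Iic_of_hasDerivAt_of_tendsto' (m := 0) hder]
  · simp
  · refine Integrable.integrableOn ?_
    simp_rw [hpdf]
    have := (integrable_mul_exp_neg_mul_sq (b := 1 / 2) (by norm_num)).const_mul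
      ((√(2 * Real.pi))⁻¹)
    refine this.congr (Eventually.of_forall fun z => ?_)
    simp only
    ring
  · simp_rw [hpdf]
    have h4 : Tendsto (fun z : ℝ => -(1 / 2) * z ^ 2) atBot atBot := by
      have : Tendsto (fun z : ℝ => z ^ 2) atBot atTop := by
        simpa [Function.comp_def] using
          (tendsto_pow_atTop (α := ℝ) two_ne_zero).comp tendsto_neg_atBot_atTop
      exact this.const_mul_atTop_of_neg (by norm_num)
    simpa using ((Real.tendsto_exp_atBot.comp h4).const_mul ((√(2 * Real.pi))⁻¹)).neg

/-- The closed form of the mean of the folded normal law. -/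
theorem foldedMean_eq_meanAbs (x : ℝ) {v : ℝ} (hv : 0 < v) : foldedMean x v = meanAbs x √v := by
  have hs : 0 < √v := Real.sqrt_pos.2 hv
  set s := √v with hs_def
  have hsv : s ^ 2 = v := Real.sq_sqrt hv.le
  set c := -x / s with hc_def
  have hlin : Integrable (fun z : ℝ => x + s * z) (gaussianReal 0 1) :=
    (integrable_const x).add (integrable_gaussian.const_mul s)
  -- The identity `|w| = w - 2 w 1_{w ≤ 0}` reduces the mean to a truncated first moment and a value
  -- of the distribution function.
  have h1 : ∀ z : ℝ, |x + s * z|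
      = (x + s * z) - 2 * (Set.Iic c).indicator (fun z => x + s * z) z := fun z => by
    by_cases hz : z ≤ c
    · rw [Set.indicator_of_mem (Set.mem_Iic.2 hz)]
      rw [hc_def, le_div_iff₀ hs] at hz
      rw [abs_of_nonpos (by linarith)]
      ring
    · rw [Set.indicator_of_notMem (by simpa using hz)]
      rw [hc_def, not_le, div_lt_iff₀ hs] at hz
      rw [abs_of_nonneg (by linarith)]
      ring
  have h2 : meanAbs x s = x - 2 * (x * cdf (gaussianReal 0 1) c - s * gaussianPDFReal 0 1 c) := by
    unfold meanAbs
    simp_rw [h1]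
    rw [integral_sub hlin ((hlin.indicator measurableSet_Iic).const_mul 2), integral_const_mul,
      integral_indicator measurableSet_Iic,
      integral_add (integrable_const _) (integrable_gaussian.const_mul s),
      integral_add (integrable_const _) (integrable_gaussian.const_mul s).integrableOn,
      integral_const_mul, integral_const_mul, setIntegral_Iic_gaussian, integral_id_gaussianReal,
      setIntegral_const, cdf_eq_real]
    simp
    ring
  rw [h2]
  unfold foldedMean
  rw [← hs_def, ← hc_def, gaussianPDFReal]
  simp only [NNReal.coe_one, mul_one, sub_zero]
  have h3 : -c ^ 2 / 2 = -(x ^ 2) / (2 * v) := by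
    rw [hc_def, div_pow, hsv]; field_simp
  have h4 : √(2 / Real.pi) = 2 * (√(2 * Real.pi))⁻¹ := by
    rw [← Real.sqrt_inv, show (2 : ℝ) / Real.pi = 2 ^ 2 * (2 * Real.pi)⁻¹ by field_simp,
      Real.sqrt_mul (by norm_num), Real.sqrt_sq (by norm_num)]
  rw [h3, h4]
  ring

section

/-! ### The global statistic -/

variable {μ : Measure ℝ} [IsProbabilityMeasure μ] {θ : ℝ}

theorem globalTerm_nonneg {n : ℕ} (k : ℕ) (σ : Config n) : 0 ≤ globalTerm k σ := abs_nonneg _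

theorem globalTerm_eq_abs_add {n : ℕ} (S : Finset (Fin n)) (σ : Config n) :
    globalTerm S.card σ = |magnetization S σ + (∑ i ∈ Sᶜ, spin (σ i)) / S.card| := by
  unfold globalTerm magnetization
  rw [← Finset.sum_add_sum_compl S, add_div]

theorem abs_integral_nullLaw_div_sub_meanAbs_le {n k : ℕ} (hk : 0 < k)
    (hsymm : μ.map (fun h => -h) = μ) (y : ℝ) :
    |∫ σ, |y + (∑ i, spin (σ i)) / k| ∂(nullLaw n μ) - meanAbs y (√n / k)|
      ≤ √n / k * absMomentDist n := by
  rcases Nat.eq_zero_or_pos n with rfl | hn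
  · simp [meanAbs]
  have hk' : (0 : ℝ) < k := by exact_mod_cast hk
  have hn' : 0 < √(n : ℝ) := Real.sqrt_pos.2 (by exact_mod_cast hn)
  have hs : 0 < √n / (k : ℝ) := by positivity
  have h1 : ∀ σ : Config n, |y + (∑ i, spin (σ i)) / k|
      = √n / k * |y / (√n / k) + (∑ i, spin (σ i)) / √n| := fun σ => by
    rw [← abs_of_pos hs, ← abs_mul, abs_of_pos hs]
    congr 1
    field_simp
  have h2 : meanAbs y (√n / k) = √n / k * meanAbs (y / (√n / k)) 1 := by
    rw [← meanAbs_mul hs.le]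
    congr 1 <;> field_simp
  simp_rw [h1]
  rw [integral_const_mul, h2, ← mul_sub, abs_mul, abs_of_pos hs]
  exact mul_le_mul_of_nonneg_left (abs_integral_nullLaw_sub_meanAbs_le μ hsymm _) hs.le

theorem integral_nullLaw_abs_div_le (hsymm : μ.map (fun h => -h) = μ) {n : ℕ}
    (A : Finset (Fin n)) (k : ℕ) :
    ∫ σ, |(∑ i ∈ A, spin (σ i)) / k| ∂(nullLaw n μ) ≤ √n / k := by
  have h1 : ∀ σ : Config n, |(∑ i ∈ A, spin (σ i)) / (k : ℝ)| = |∑ i ∈ A, spin (σ i)| / k :=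
    fun σ => by rw [abs_div, Nat.abs_cast]
  simp_rw [h1]
  rw [integral_div]
  refine div_le_div_of_nonneg_right ((integral_nullLaw_abs_sum_le μ hsymm A).trans
    (Real.sqrt_le_sqrt ?_)) (Nat.cast_nonneg k)
  exact_mod_cast A.card_le_univ.trans (by simp)

/-- Filling in the missing spins on `S` changes the mean by at most `E|∑ i ∈ S, σ i| / k ≤ 1 / √k`.
The Gaussian comparison can then be made with all `n` spins, whatever the size of the complement. -/
theorem abs_integral_nullLaw_compl_sub_meanAbs_le {n : ℕ}
    (hsymm : μ.map (fun h => -h) = μ) (S : Finset (Fin n)) (hS : 0 < S.card) (y : ℝ) :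
    |∫ σ, |y + (∑ i ∈ Sᶜ, spin (σ i)) / S.card| ∂(nullLaw n μ) - meanAbs y (√n / S.card)|
      ≤ √n / S.card * absMomentDist n + 1 / √S.card := by
  have hk : (0 : ℝ) < S.card := by exact_mod_cast hS
  have h1 := abs_integral_nullLaw_div_sub_meanAbs_le (n := n) hS hsymm y
  have h2 : |∫ σ, |y + (∑ i ∈ Sᶜ, spin (σ i)) / S.card| ∂(nullLaw n μ)
      - ∫ σ, |y + (∑ i, spin (σ i)) / S.card| ∂(nullLaw n μ)| ≤ 1 / √S.card := by
    rw [← integral_sub .of_finite .of_finite]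
    refine abs_integral_le_integral_abs.trans ?_
    have h3 : ∫ σ, |(∑ i ∈ S, spin (σ i))| / S.card ∂(nullLaw n μ) ≤ 1 / √S.card := by
      rw [integral_div, div_le_div_iff₀ hk (Real.sqrt_pos.2 hk)]
      have := integral_nullLaw_abs_sum_le μ hsymm S
      calc _ ≤ √S.card * √S.card := by gcongr
        _ = _ := by rw [Real.mul_self_sqrt hk.le, one_mul]
    refine (integral_mono .of_finite .of_finite fun σ => ?_).trans h3
    simp only
    refine (abs_abs_sub_abs_le_abs_sub _ _).trans (le_of_eq ?_)
    rw [← Finset.sum_add_sum_compl S, ← abs_neg, ← Nat.abs_cast S.card, ← abs_div, Nat.abs_cast]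
    congr 1
    field_simp
    ring
  calc _ ≤ _ := abs_sub_le _ (∫ σ, |y + (∑ i, spin (σ i)) / S.card| ∂(nullLaw n μ)) _
    _ ≤ _ := by linarith

/-- Given the clique, the statistic is a shifted sum of uniform spins; the uniformity of the
Gaussian comparison in the shift allows averaging over `m_S` without knowing its law. -/
theorem abs_integral_cliqueLaw_globalTerm_sub_le {n : ℕ}
    (hsymm : μ.map (fun h => -h) = μ) (S : Finset (Fin n)) (hS : 0 < S.card) :
    |∫ σ, globalTerm S.card σ ∂(cliqueLaw μ θ S)
      - ∫ σ, meanAbs (magnetization S σ) (√n / S.card) ∂(cliqueLaw μ θ S)|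
      ≤ √n / S.card * absMomentDist n + 1 / √S.card := by
  simp_rw [globalTerm_eq_abs_add S]
  rw [integral_cliqueLaw_resample μ hsymm θ S (fun m w => |m + w / S.card|),
    ← integral_sub .of_finite .of_finite, ← Real.norm_eq_abs]
  refine (norm_integral_le_of_norm_le_const (Eventually.of_forall fun σ =>
    abs_integral_nullLaw_compl_sub_meanAbs_le hsymm S hS (magnetization S σ))).trans ?_
  simp

theorem integral_nullLaw_globalTerm_sq (hsymm : μ.map (fun h => -h) = μ) (n k : ℕ) :
    ∫ σ, globalTerm k σ ^ 2 ∂(nullLaw n μ) = (√n / k) ^ 2 := by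
  simp only [globalTerm, sq_abs, div_pow]
  rw [integral_div, integral_nullLaw_sum_sq μ hsymm, Real.sq_sqrt (Nat.cast_nonneg n)]
  simp

theorem integral_cliqueLaw_globalTerm_sq_le {n : ℕ} (hsymm : μ.map (fun h => -h) = μ)
    (S : Finset (Fin n)) :
    ∫ σ, globalTerm S.card σ ^ 2 ∂(cliqueLaw μ θ S) ≤ 2 + 2 * (√n / S.card) ^ 2 := by
  simp_rw [globalTerm_eq_abs_add S, sq_abs]
  rw [integral_cliqueLaw_resample μ hsymm θ S (fun m w => (m + w / S.card) ^ 2)]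
  have h : ∀ σ : Config n,
      ∫ ε, (magnetization S σ + (∑ i ∈ Sᶜ, spin (ε i)) / S.card) ^ 2 ∂(nullLaw n μ)
        ≤ 2 + 2 * (√n / S.card) ^ 2 := fun σ => by
    calc ∫ ε, (magnetization S σ + (∑ i ∈ Sᶜ, spin (ε i)) / S.card) ^ 2 ∂(nullLaw n μ)
        ≤ ∫ ε, (2 + 2 / (S.card : ℝ) ^ 2 * (∑ i ∈ Sᶜ, spin (ε i)) ^ 2) ∂(nullLaw n μ) := by
          refine integral_mono .of_finite .of_finite fun ε => ?_
          have h1 := (sq_le_one_iff_abs_le_one _).2 (abs_magnetization_le S σ)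
          have h2 := sq_nonneg (magnetization S σ - (∑ i ∈ Sᶜ, spin (ε i)) / S.card)
          have h3 : 2 / (S.card : ℝ) ^ 2 * (∑ i ∈ Sᶜ, spin (ε i)) ^ 2
            = 2 * ((∑ i ∈ Sᶜ, spin (ε i)) / S.card) ^ 2 := by ring
          simp only [h3]
          nlinarith
      _ = 2 + 2 / (S.card : ℝ) ^ 2 * (Sᶜ.card : ℝ) := by
          rw [integral_add .of_finite .of_finite, integral_const_mul,
            integral_nullLaw_sum_sq μ hsymm]
          simp
      _ ≤ _ := by
          rw [div_pow, Real.sq_sqrt (Nat.cast_nonneg n), div_mul_eq_mul_div, mul_div_assoc]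
          have : (Sᶜ.card : ℝ) ≤ n := by exact_mod_cast Sᶜ.card_le_univ.trans (by simp)
          gcongr
  refine (integral_mono .of_finite (integrable_const (2 + 2 * (√n / S.card) ^ 2)) h).trans ?_
  simp

/-! ### Concentration of the two parts of the global statistic -/

theorem cliqueLaw_abs_compl_le {n : ℕ} (hsymm : μ.map (fun h => -h) = μ) (S : Finset (Fin n))
    {c : ℝ} (hc : 0 < c) :
    (cliqueLaw μ θ S).real {σ | c ≤ |(∑ i ∈ Sᶜ, spin (σ i)) / S.card|} ≤ √n / S.card / c := by
  rw [le_div_iff₀ hc, mul_comm]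
  refine (mul_meas_ge_le_integral_of_nonneg (Eventually.of_forall fun σ => abs_nonneg _)
    .of_finite c).trans ?_
  rw [integral_cliqueLaw_resample μ hsymm θ S (fun _ w => |w / S.card|)]
  refine (integral_mono .of_finite (integrable_const (√n / S.card)) fun σ =>
    integral_nullLaw_abs_div_le hsymm Sᶜ S.card).trans ?_
  simp

theorem cliqueLaw_abs_magnetization_small (hsymm : μ.map (fun h => -h) = μ) (hθ : 0 < θ)
    {x τ η : ℝ} (hx : x ∈ positiveSolutions μ θ)
    (hbelow : ∀ y, 0 < y → y < x → y < meanTanh μ θ y) (hτ : 0 < τ) (hτx : τ < x) (hη : 0 < η) :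
    ∃ K : ℕ, ∀ (n : ℕ) (S : Finset (Fin n)), K ≤ S.card →
      (cliqueLaw μ θ S).real {σ | |magnetization S σ| ≤ τ} ≤ η := by
  obtain ⟨δ, hδ, h⟩ := freeEnergy_gap hsymm hθ hbelow hτ hτx
  have hx1 : |x| ≤ 1 := by rw [abs_of_pos hx.1]; exact positiveSolutions_le_one hx
  exact cliqueLaw_magnetization_mem_small hθ hx1 hδ {y | |y| ≤ τ} h η hη

theorem cliqueLaw_abs_magnetization_sub_small (hsymm : μ.map (fun h => -h) = μ) (hθ : 0 < θ)
    {x ε η : ℝ} (hx : x ∈ positiveSolutions μ θ)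
    (hbelow : ∀ y, 0 < y → y < x → y < meanTanh μ θ y)
    (huniq : ∀ y ∈ positiveSolutions μ θ, y = x) (hε : 0 < ε) (hη : 0 < η) :
    ∃ K : ℕ, ∀ (n : ℕ) (S : Finset (Fin n)), K ≤ S.card →
      (cliqueLaw μ θ S).real {σ | ε ≤ |(|magnetization S σ| - x)|} ≤ η := by
  obtain ⟨δ, hδ, h⟩ := freeEnergy_gap_of_unique hsymm hθ hx hbelow huniq hε
  have hx1 : |x| ≤ 1 := by rw [abs_of_pos hx.1]; exact positiveSolutions_le_one hx
  exact cliqueLaw_magnetization_mem_small hθ hx1 hδ {y | ε ≤ |(|y| - x)|} h η hη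

/-! ### The scan test -/

/-- Chernoff bound with parameter `τ` for the unnormalized sums. The moment generating function of
`|∑ σ i|` is at most `2 exp (k τ² / 2)`; the hypothesis on `log 2` absorbs the factor two into a
total exponent `3 k τ² / 4`. Against the threshold `k τ²` this leaves `k τ² / 4` per sample. -/
theorem nullSampleLaw_localStat_ge_le {n m : ℕ} (hsymm : μ.map (fun h => -h) = μ)
    (S : Finset (Fin n)) (hS : 0 < S.card) (hm : 1 ≤ m) {τ : ℝ} (hτ : 0 < τ)
    (hk : Real.log 2 ≤ S.card * τ ^ 2 / 4) :
    (nullSampleLaw n m μ).real {X | τ ≤ localStat S X}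
      ≤ Real.exp (-(S.card * (m * τ ^ 2 / 4))) := by
  have hk' : (0 : ℝ) < S.card := by exact_mod_cast hS
  have hm' : (0 : ℝ) < m := by exact_mod_cast hm
  have : IsProbabilityMeasure (nullSampleLaw n m μ) := by unfold nullSampleLaw; infer_instance
  let f : Config n → ℝ := fun σ => Real.exp (τ * |∑ i ∈ S, spin (σ i)|)
  have hf : ∫ σ, f σ ∂(nullLaw n μ) ≤ Real.exp (S.card * τ ^ 2 * (3 / 4)) := by
    calc ∫ σ, f σ ∂(nullLaw n μ)
        ≤ ∫ σ, (Real.exp (τ * ∑ i ∈ S, spin (σ i)) + Real.exp (-τ * ∑ i ∈ S, spin (σ i)))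
            ∂(nullLaw n μ) := by
          refine integral_mono .of_finite .of_finite fun σ => ?_
          simp only [f]
          rcases abs_choice (∑ i ∈ S, spin (σ i)) with h | h <;> rw [h]
          · exact le_add_of_nonneg_right (Real.exp_pos _).le
          · rw [mul_neg, ← neg_mul]; exact le_add_of_nonneg_left (Real.exp_pos _).le
      _ = 2 * Real.cosh τ ^ S.card := by
          rw [integral_add .of_finite .of_finite, integral_nullLaw_exp μ hsymm,
            integral_nullLaw_exp μ hsymm, Real.cosh_neg]
          ring
      _ ≤ Real.exp (Real.log 2) * Real.exp (τ ^ 2 / 2) ^ S.card := by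
          rw [Real.exp_log two_pos]
          gcongr
          exact Real.cosh_le_exp_half_sq τ
      _ ≤ Real.exp (S.card * τ ^ 2 * (3 / 4)) := by
          rw [← Real.exp_nat_mul, ← Real.exp_add]
          refine Real.exp_le_exp.2 ?_
          linarith
  have h1 := mul_meas_ge_le_integral_of_nonneg (μ := nullSampleLaw n m μ)
    (f := fun X => ∏ j, f (X j)) (Eventually.of_forall fun X =>
      Finset.prod_nonneg fun j _ => (Real.exp_pos _).le) .of_finite
    (Real.exp (m * (S.card * τ ^ 2)))
  have h2 : ∫ X : Fin m → Config n, ∏ j, f (X j) ∂(nullSampleLaw n m μ)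
      = (∫ σ, f σ ∂(nullLaw n μ)) ^ m := by
    rw [nullSampleLaw, integral_fintype_prod_eq_pow, Fintype.card_fin]
  have h3 : (∫ σ, f σ ∂(nullLaw n μ)) ^ m ≤ Real.exp (m * (S.card * τ ^ 2 * (3 / 4))) := by
    rw [Real.exp_nat_mul]
    exact pow_le_pow_left₀ (integral_nonneg fun σ => (Real.exp_pos _).le) hf m
  have hsub : {X : Fin m → Config n | τ ≤ localStat S X}
      ⊆ {X | Real.exp (m * (S.card * τ ^ 2)) ≤ ∏ j, f (X j)} := by
    intro X hX
    have hX' : τ ≤ localStat S X := hX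
    unfold localStat magnetization at hX'
    simp_rw [abs_div, Nat.abs_cast] at hX'
    rw [← Finset.sum_div, div_div, le_div_iff₀ (by positivity)] at hX'
    change _ ≤ ∏ j, Real.exp (τ * |∑ i ∈ S, spin (X j i)|)
    rw [← Real.exp_sum, ← Finset.mul_sum]
    refine Real.exp_le_exp.2 ?_
    calc (m : ℝ) * (S.card * τ ^ 2) = τ * (τ * (S.card * m)) := by ring
      _ ≤ _ := mul_le_mul_of_nonneg_left hX' hτ.le
  have h4 := (mul_le_mul_of_nonneg_left (measureReal_mono (μ := nullSampleLaw n m μ) hsub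
    (measure_ne_top _ _)) (Real.exp_pos _).le).trans
    (h1.trans (h2.le.trans h3))
  rw [← le_div_iff₀' (Real.exp_pos _), ← Real.exp_sub] at h4
  refine h4.trans (Real.exp_le_exp.2 (le_of_eq ?_))
  ring

theorem nullSampleLaw_scanStat_ge_le {n m k : ℕ} (hsymm : μ.map (fun h => -h) = μ) (hk : 0 < k)
    (hkn : k ≤ n) (hm : 1 ≤ m) {τ : ℝ} (hτ : 0 < τ) (hk2 : Real.log 2 ≤ k * τ ^ 2 / 4)
    (hmn : 8 / τ ^ 2 * Real.log n ≤ m) :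
    (nullSampleLaw n m μ).real {X | τ ≤ scanStat k X} ≤ 1 / k := by
  have hn : 0 < n := hk.trans_le hkn
  have hn' : (0 : ℝ) < n := by exact_mod_cast hn
  have hne : Nonempty {S : Finset (Fin n) // S.card = k} := by
    obtain ⟨S, _, hS⟩ := Finset.exists_subset_card_eq (s := (Finset.univ : Finset (Fin n)))
      (by simpa using hkn)
    exact ⟨⟨S, hS⟩⟩
  have hsub : {X : Fin m → Config n | τ ≤ scanStat k X}
      ⊆ ⋃ S ∈ Finset.powersetCard k (Finset.univ : Finset (Fin n)), {X | τ ≤ localStat S X} := by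
    intro X hX
    obtain ⟨S, hS⟩ := exists_eq_ciSup_of_finite
      (f := fun S : {S : Finset (Fin n) // S.card = k} => localStat S.1 X)
    refine Set.mem_biUnion (x := S.1) (by simp [Finset.mem_powersetCard, S.2]) ?_
    change τ ≤ localStat S.1 X
    rw [hS]
    exact hX
  have : IsProbabilityMeasure (nullSampleLaw n m μ) := by unfold nullSampleLaw; infer_instance
  refine (measureReal_mono hsub (measure_ne_top _ _)).trans
    ((measureReal_biUnion_finset_le _ _).trans ?_)
  have h1 : ∀ S ∈ Finset.powersetCard k (Finset.univ : Finset (Fin n)),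
      (nullSampleLaw n m μ).real {X | τ ≤ localStat S X} ≤ Real.exp (-(k * (m * τ ^ 2 / 4))) := by
    intro S hS
    rw [Finset.mem_powersetCard] at hS
    rw [← hS.2] at hk hk2 ⊢
    exact nullSampleLaw_localStat_ge_le hsymm S hk hm hτ hk2
  refine (Finset.sum_le_card_nsmul _ _ _ h1).trans ?_
  rw [Finset.card_powersetCard, Finset.card_univ, Fintype.card_fin, nsmul_eq_mul]
  have h2 : ((n.choose k : ℕ) : ℝ) ≤ Real.exp (k * Real.log n) := by
    rw [Real.exp_nat_mul, Real.exp_log hn']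
    exact_mod_cast Nat.choose_le_pow n k
  -- The constant `8 / τ²` gives an exponent of `2 * log n` per clique vertex: one half pays for the
  -- at most `n ^ k` candidate sets, and the other leaves `n ^ (-k)`.
  have h3 : 2 * Real.log n ≤ m * τ ^ 2 / 4 := by
    rw [div_mul_eq_mul_div, div_le_iff₀ (by positivity)] at hmn
    linarith
  have hlog : 0 ≤ Real.log n := Real.log_natCast_nonneg n
  have hk1 : (1 : ℝ) ≤ k := by exact_mod_cast hk
  calc ((n.choose k : ℕ) : ℝ) * Real.exp (-(k * (m * τ ^ 2 / 4)))
      ≤ Real.exp (k * Real.log n) * Real.exp (-(k * (2 * Real.log n))) := by gcongr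
    _ = Real.exp (-(k * Real.log n)) := by rw [← Real.exp_add]; ring_nf
    _ ≤ Real.exp (-Real.log n) := by
        refine Real.exp_le_exp.2 (neg_le_neg ?_)
        nlinarith
    _ = 1 / n := by rw [Real.exp_neg, Real.exp_log hn', one_div]
    _ ≤ 1 / k := one_div_le_one_div_of_le (by positivity) (by exact_mod_cast hkn)

theorem localStat_le_scanStat {n m : ℕ} (S : Finset (Fin n)) (X : Fin m → Config n) :
    localStat S X ≤ scanStat S.card X :=
  le_ciSup (f := fun T : {T : Finset (Fin n) // T.card = S.card} => localStat T.1 X)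
    (Set.finite_range _).bddAbove ⟨S, rfl⟩

theorem scanTest_consistent (hsymm : μ.map (fun h => -h) = μ) (hθ : 0 < θ)
    {x : ℝ} (hx : x ∈ positiveSolutions μ θ)
    (hbelow : ∀ y, 0 < y → y < x → y < meanTanh μ θ y) :
    ∀ τ ∈ Set.Ioo 0 x, ∃ C > 0, ∀ δ > 0, ∃ K : ℕ, ∀ n m k : ℕ, K ≤ k →
        C * Real.log n ≤ m → ∀ S : Finset (Fin n), S.card = k →
          totalError (m := m) μ θ (scanStat k) τ S ≤ δ := by
  rintro τ ⟨hτ, hτx⟩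
  refine ⟨8 / τ ^ 2, by positivity, fun δ hδ => ?_⟩
  -- A level strictly between `τ` and `x` leaves room on both sides: for the large deviation bound
  -- below `x`, and for Markov's inequality above `τ`.
  have hττ' : τ < (τ + x) / 2 := by linarith
  set τ' := (τ + x) / 2 with hτ'
  have hpos : 0 < 1 - τ / τ' := by rw [sub_pos, div_lt_one (hτ.trans hττ')]; exact hττ'
  obtain ⟨K₁, hK₁⟩ := cliqueLaw_abs_magnetization_small hsymm hθ hx hbelow
    (hτ.trans hττ') (by linarith : τ' < x) (show 0 < (1 - τ / τ') * (δ / 2) by positivity)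
  obtain ⟨K₂, hK₂⟩ := exists_nat_ge (Real.log 2 * 4 / τ ^ 2)
  obtain ⟨K₃, hK₃⟩ := exists_nat_ge (2 / δ)
  -- The value `2` forces `n ≥ 2`, so that `log n > 0` and the sample size condition implies `m ≥
  -- 1`.
  refine ⟨max (max K₁ K₂) (max K₃ 2), fun n m k hk hm S hS => ?_⟩
  simp only [max_le_iff] at hk
  obtain ⟨⟨hk1, hk2⟩, hk3, hk4⟩ := hk
  have hkn : k ≤ n := by rw [← hS]; simpa using S.card_le_univ
  have hm1 : 1 ≤ m := by
    have h2 : 0 < Real.log n := Real.log_pos (by exact_mod_cast (by omega : 1 < n))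
    have : (0 : ℝ) < m := lt_of_lt_of_le (by positivity) hm
    exact_mod_cast this
  have hkR : (0 : ℝ) < k := by exact_mod_cast (by omega : 0 < k)
  have hnull := nullSampleLaw_scanStat_ge_le (n := n) (m := m) (k := k) hsymm (by omega) hkn hm1 hτ
    (by
      have : (K₂ : ℝ) ≤ k := by exact_mod_cast hk2
      have := hK₂.trans this
      rw [div_le_iff₀ (by positivity)] at this
      linarith) hm
  have hnull2 : 1 / (k : ℝ) ≤ δ / 2 := by
    have : (K₃ : ℝ) ≤ k := by exact_mod_cast hk3
    have := hK₃.trans this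
    rw [div_le_iff₀ hδ] at this
    rw [div_le_iff₀ hkR]
    linarith
  have halt := real_sampleAvg_lt_le hm1 (cliqueLaw μ θ S)
    (f := fun σ => |magnetization S σ|) (fun σ => abs_nonneg _) hτ hττ'
  have hsub : {σ : Config n | |magnetization S σ| < τ'} ⊆ {σ | |magnetization S σ| ≤ τ'} := by
    intro σ hσ
    have h : |magnetization S σ| < τ' := hσ
    exact h.le
  have hmono := (measureReal_mono (μ := cliqueLaw μ θ S) hsub).trans (hK₁ n S (by omega))
  have halt2 : (cliqueSampleLaw m μ θ S).real {X | scanStat k X < τ} ≤ δ / 2 := by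
    refine (measureReal_mono (fun X hX => ?_)
      (by unfold cliqueSampleLaw; exact measure_ne_top _ _)).trans (halt.trans ?_)
    · have h1 : scanStat k X < τ := hX
      rw [← hS] at h1
      exact (localStat_le_scanStat S X).trans_lt h1
    · rw [div_le_iff₀ hpos]
      linarith
  unfold totalError
  linarith

/-! ### The global test for large cliques -/

theorem integral_nullLaw_globalTerm_le (hsymm : μ.map (fun h => -h) = μ) (n k : ℕ) :
    ∫ σ, globalTerm k σ ∂(nullLaw n μ) ≤ √n / k :=
  integral_nullLaw_abs_div_le hsymm Finset.univ k

theorem sqrt_div_le {n k : ℕ} {A : ℝ} (hk : 0 < k) (hA : 0 < A) (h : A * √n ≤ k) :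
    √n / k ≤ 1 / A := by
  rw [div_le_div_iff₀ (by exact_mod_cast hk) hA]
  linarith

/-- Since `k ≤ n`, the inequality `A * √n ≤ k` forces `A ≤ √k`. A large ratio to `√n` thus makes the
clique itself large, as the concentration of `m_S` requires. -/
theorem le_card_of_sqrt {n k K : ℕ} {A : ℝ} (hk : 0 < k) (hkn : k ≤ n) (hA : √K ≤ A)
    (h : A * √n ≤ k) : K ≤ k := by
  have hk' : (0 : ℝ) < k := by exact_mod_cast hk
  have h1 : √(k : ℝ) ≤ √n := Real.sqrt_le_sqrt (by exact_mod_cast hkn)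
  have h2 : √K * √k ≤ k := by
    refine le_trans ?_ h
    have := (Real.sqrt_nonneg (K : ℝ)).trans hA
    gcongr
  have h3 : √K ≤ √k := by
    have h4 : √(k : ℝ) * √k = k := Real.mul_self_sqrt hk'.le
    have h5 : 0 < √(k : ℝ) := Real.sqrt_pos.2 hk'
    nlinarith
  have h6 := (Real.sqrt_le_sqrt_iff (Nat.cast_nonneg k)).1 h3
  exact_mod_cast h6

theorem globalTerm_null_small (hsymm : μ.map (fun h => -h) = μ) :
    ∀ ε > 0, ∀ δ > 0, ∃ A : ℝ, ∀ n k : ℕ, 0 < k → A * √n ≤ k →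
        (nullLaw n μ).real {σ | ε ≤ globalTerm k σ} ≤ δ := by
  intro ε hε δ hδ
  refine ⟨1 / (ε * δ), fun n k hk h => ?_⟩
  have h1 := sqrt_div_le hk (by positivity) h
  have h2 := mul_meas_ge_le_integral_of_nonneg (μ := nullLaw n μ) (f := globalTerm k)
    (Eventually.of_forall fun σ => globalTerm_nonneg k σ) .of_finite ε
  have h3 := integral_nullLaw_globalTerm_le hsymm n k
  rw [one_div_one_div] at h1
  exact le_of_mul_le_mul_left (by linarith) hε

theorem globalTest_large_consistent (hsymm : μ.map (fun h => -h) = μ) (hθ : 0 < θ)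
    {x : ℝ} (hx : x ∈ positiveSolutions μ θ)
    (hbelow : ∀ y, 0 < y → y < x → y < meanTanh μ θ y) :
    ∀ τ ∈ Set.Ioo 0 x, ∀ δ > 0, ∃ A : ℝ, ∀ n m k : ℕ, 0 < k → 1 ≤ m → A * √n ≤ k →
        ∀ S : Finset (Fin n), S.card = k →
          totalError (m := m) μ θ (globalStat k) τ S ≤ δ := by
  rintro τ ⟨hτ, hτx⟩ δ hδ
  have hττ' : τ < (τ + x) / 2 := by linarith
  set τ' := (τ + x) / 2 with hτ'
  have hτ'x : τ' < x := by linarith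
  have hpos : 0 < 1 - τ / τ' := by rw [sub_pos, div_lt_one (hτ.trans hττ')]; exact hττ'
  set c := (x - τ') / 2 with hc
  have hc0 : 0 < c := by linarith
  set η := (1 - τ / τ') * (δ / 4) with hη
  have hη0 : 0 < η := by positivity
  obtain ⟨K, hK⟩ := cliqueLaw_abs_magnetization_small hsymm hθ hx hbelow
    (by linarith : 0 < τ' + c) (by linarith : τ' + c < x) hη0
  -- The three entries make the clique large enough for concentration, the null mean of the
  -- statistic at most `τ * δ / 2`, and the off-clique term smaller than `c` up to probability `η`.
  refine ⟨max √K (max (2 / (τ * δ)) (1 / (c * η))), fun n m k hk hm h S hS => ?_⟩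
  have hkn : k ≤ n := by rw [← hS]; simpa using S.card_le_univ
  have hKk : K ≤ k := le_card_of_sqrt hk hkn (le_max_left _ _) h
  have hs0 : 0 ≤ √(n : ℝ) := Real.sqrt_nonneg _
  have hs1 : √n / k ≤ τ * δ / 2 := by
    have := sqrt_div_le (A := 2 / (τ * δ)) hk (by positivity) (le_trans (mul_le_mul_of_nonneg_right
      ((le_max_left _ _).trans (le_max_right _ _)) hs0) h)
    rwa [one_div_div] at this
  have hs2 : √n / k ≤ c * η := by
    have := sqrt_div_le (A := 1 / (c * η)) hk (by positivity) (le_trans (mul_le_mul_of_nonneg_right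
      ((le_max_right _ _).trans (le_max_right _ _)) hs0) h)
    rwa [one_div_one_div] at this
  have hnull : (nullSampleLaw n m μ).real {X | τ ≤ globalStat k X} ≤ δ / 2 := by
    refine (real_le_sampleAvg_le hm (nullLaw n μ) (globalTerm_nonneg k) hτ).trans ?_
    rw [div_le_iff₀ hτ]
    have := integral_nullLaw_globalTerm_le hsymm n k
    linarith
  have hone : (cliqueLaw μ θ S).real {σ | globalTerm k σ < τ'} ≤ η + η := by
    have hsub : {σ : Config n | globalTerm k σ < τ'} ⊆ {σ | |magnetization S σ| ≤ τ' + c}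
        ∪ {σ | c ≤ |(∑ i ∈ Sᶜ, spin (σ i)) / S.card|} := by
      intro σ hσ
      by_contra hcon
      simp only [Set.mem_union, Set.mem_ofPred_eq, not_or, not_le] at hcon
      have h1 : globalTerm k σ < τ' := hσ
      rw [← hS, globalTerm_eq_abs_add] at h1
      have h2 := abs_sub_abs_le_abs_sub (magnetization S σ) (-((∑ i ∈ Sᶜ, spin (σ i)) / S.card))
      rw [abs_neg, sub_neg_eq_add] at h2
      linarith [hcon.1, hcon.2]
    refine (measureReal_mono hsub).trans ((measureReal_union_le _ _).trans
      (add_le_add (hK n S (by omega)) ((cliqueLaw_abs_compl_le hsymm S hc0).trans ?_)))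
    rw [div_le_iff₀ hc0, hS]
    linarith
  have halt : (cliqueSampleLaw m μ θ S).real {X | globalStat k X < τ} ≤ δ / 2 := by
    refine (real_sampleAvg_lt_le hm (cliqueLaw μ θ S) (globalTerm_nonneg k) hτ hττ').trans ?_
    rw [div_le_iff₀ hpos]
    linarith
  unfold totalError
  linarith

theorem globalTerm_clique_small (hsymm : μ.map (fun h => -h) = μ) (hθ : 0 < θ)
    {x : ℝ} (hx : x ∈ positiveSolutions μ θ)
    (hbelow : ∀ y, 0 < y → y < x → y < meanTanh μ θ y)
    (huniq : ∀ y ∈ positiveSolutions μ θ, y = x) :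
    ∀ ε > 0, ∀ δ > 0, ∃ A : ℝ, ∀ n k : ℕ, 0 < k → A * √n ≤ k →
          ∀ S : Finset (Fin n), S.card = k →
            (cliqueLaw μ θ S).real {σ | ε ≤ |globalTerm k σ - x|} ≤ δ := by
  intro ε hε δ hδ
  obtain ⟨K, hK⟩ := cliqueLaw_abs_magnetization_sub_small hsymm hθ hx hbelow huniq
    (half_pos hε) (half_pos hδ)
  refine ⟨max √K (1 / (ε / 2 * (δ / 2))), fun n k hk h S hS => ?_⟩
  have hkn : k ≤ n := by rw [← hS]; simpa using S.card_le_univ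
  have hKk : K ≤ k := le_card_of_sqrt hk hkn (le_max_left _ _) h
  have hs : √n / k ≤ ε / 2 * (δ / 2) := by
    have := sqrt_div_le (A := 1 / (ε / 2 * (δ / 2))) hk (by positivity)
      (le_trans (mul_le_mul_of_nonneg_right (le_max_right _ _) (Real.sqrt_nonneg _)) h)
    rwa [one_div_one_div] at this
  have hsub : {σ : Config n | ε ≤ |globalTerm k σ - x|}
      ⊆ {σ | ε / 2 ≤ |(|magnetization S σ| - x)|}
        ∪ {σ | ε / 2 ≤ |(∑ i ∈ Sᶜ, spin (σ i)) / S.card|} := by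
    intro σ hσ
    by_contra hcon
    simp only [Set.mem_union, Set.mem_ofPred_eq, not_or, not_le] at hcon
    have h1 : ε ≤ |globalTerm k σ - x| := hσ
    rw [← hS, globalTerm_eq_abs_add] at h1
    have h2 := abs_abs_sub_abs_le_abs_sub
      (magnetization S σ + (∑ i ∈ Sᶜ, spin (σ i)) / S.card) (magnetization S σ)
    rw [add_sub_cancel_left] at h2
    have h3 := abs_sub_le |magnetization S σ + (∑ i ∈ Sᶜ, spin (σ i)) / S.card|
      |magnetization S σ| x
    linarith [hcon.1, hcon.2]
  refine (measureReal_mono hsub).trans ((measureReal_union_le _ _).trans ?_)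
  have h1 := hK n S (by omega)
  have h2 : (cliqueLaw μ θ S).real {σ | ε / 2 ≤ |(∑ i ∈ Sᶜ, spin (σ i)) / S.card|} ≤ δ / 2 := by
    refine (cliqueLaw_abs_compl_le hsymm S (half_pos hε)).trans ?_
    rw [div_le_iff₀ (half_pos hε), hS]
    linarith
  linarith

end

section

/-! ### The global test for cliques of size of order `√n` -/

variable {μ : Measure ℝ} [IsProbabilityMeasure μ] {θ : ℝ}

/-- Where `|m_S| > x - r`, monotonicity and the Lipschitz bound lose at most `r`. On the exceptional
event the loss is at most `x`, since `meanAbs` is least at zero. No upper control of `m_S` is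
needed, hence no uniqueness of the solution. -/
theorem integral_meanAbs_magnetization_ge {n : ℕ} (S : Finset (Fin n)) {x r s : ℝ} (hx : 0 < x)
    (hr : 0 ≤ r) (hrx : r ≤ x) :
    meanAbs x s - r - x * (cliqueLaw μ θ S).real {σ | |magnetization S σ| ≤ x - r}
      ≤ ∫ σ, meanAbs (magnetization S σ) s ∂(cliqueLaw μ θ S) := by
  let B : Set (Config n) := {σ | |magnetization S σ| ≤ x - r}
  have hint : ∫ σ, (meanAbs x s - r - x * B.indicator 1 σ) ∂(cliqueLaw μ θ S)
      = meanAbs x s - r - x * (cliqueLaw μ θ S).real B := by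
    rw [integral_sub .of_finite .of_finite, integral_const_mul,
      integral_indicator_one (Set.toFinite _).measurableSet]
    simp
  rw [← hint]
  refine integral_mono .of_finite .of_finite fun σ => ?_
  have h0 : meanAbs x s ≤ meanAbs (x - r) s + r := by
    have := meanAbs_sub_le x (x - r) s s
    rw [sub_sub_cancel, abs_of_nonneg hr, sub_self, abs_zero] at this
    linarith
  by_cases hσ : |magnetization S σ| ≤ x - r
  · have h1 : B.indicator (1 : Config n → ℝ) σ = 1 := Set.indicator_of_mem (s := B) hσ _
    simp only [h1]
    have h2 := meanAbs_mono (y := 0) (y' := magnetization S σ) (by simp) s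
    have h3 := meanAbs_sub_le x 0 s s
    rw [sub_zero, abs_of_pos hx, sub_self, abs_zero] at h3
    linarith
  · have h1 : B.indicator (1 : Config n → ℝ) σ = 0 := Set.indicator_of_notMem (s := B) hσ _
    simp only [h1]
    have h2 := meanAbs_mono (y := x - r) (y' := magnetization S σ)
      (by rw [abs_of_nonneg (by linarith)]; linarith) s
    linarith

theorem globalTest_critical_consistent (hsymm : μ.map (fun h => -h) = μ) (hθ : 0 < θ)
    {x : ℝ} (hx : x ∈ positiveSolutions μ θ)
    (hbelow : ∀ y, 0 < y → y < x → y < meanTanh μ θ y) :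
    ∀ a b : ℝ, 0 < a → a ≤ b → ∀ t ∈ Set.Ioo (0 : ℝ) 1, ∀ δ > 0, ∃ M N : ℕ,
        ∀ n m k : ℕ, N ≤ n → M ≤ m → a * √n ≤ k → k ≤ b * √n →
          ∀ S : Finset (Fin n), S.card = k →
            totalError (m := m) μ θ (globalStat k)
              ((1 - t) * foldedMean 0 ((n : ℝ) / k ^ 2) + t * foldedMean x ((n : ℝ) / k ^ 2)) S
                ≤ δ := by
  rintro a b ha _ t ⟨ht0, ht1⟩ δ hδ
  have hx0 : 0 < x := hx.1
  obtain ⟨γ, hγ, hgap⟩ := exists_meanAbs_gap hx0 (one_div_pos.2 ha)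
  have hmin : 0 < min t (1 - t) := lt_min ht0 (by linarith)
  -- Under the alternative five errors of size `r` are budgeted: the Gaussian approximation, the
  -- completion of the sum over the clique, the shift from `x` to `x - r`, the exceptional event,
  -- and the deviation of the sample average.
  obtain ⟨r, hr0, hrx, hrt, hrt'⟩ : ∃ r > 0, r < x ∧ r * 5 ≤ t * γ ∧ r * 5 ≤ (1 - t) * γ := by
    refine ⟨min (x / 2) (min t (1 - t) * γ / 5), by positivity,
      (min_le_left _ _).trans_lt (by linarith), ?_, ?_⟩
    · have h1 := min_le_right (x / 2) (min t (1 - t) * γ / 5)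
      have h2 := mul_le_mul_of_nonneg_right (min_le_left t (1 - t)) hγ.le
      linarith
    · have h1 := min_le_right (x / 2) (min t (1 - t) * γ / 5)
      have h2 := mul_le_mul_of_nonneg_right (min_le_right t (1 - t)) hγ.le
      linarith
  obtain ⟨K, hK⟩ := cliqueLaw_abs_magnetization_small hsymm hθ hx hbelow
    (by linarith : 0 < x - r) (by linarith : x - r < x) (show 0 < r / x by positivity)
  obtain ⟨M, hM⟩ := exists_nat_ge (2 * (2 + 2 * (1 / a) ^ 2) / (δ * r ^ 2))
  have hsqrt : Tendsto (fun n : ℕ => a * √(n : ℝ)) atTop atTop :=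
    (Real.tendsto_sqrt_atTop.comp tendsto_natCast_atTop_atTop).const_mul_atTop ha
  obtain ⟨N, hN⟩ := eventually_atTop.1 ((tendsto_absMomentDist.eventually
    (ge_mem_nhds (show 0 < a * r by positivity))).and
    (hsqrt.eventually_ge_atTop (max 1 (max K (1 / r ^ 2)))))
  refine ⟨M + 1, N, fun n m k hn hm hak _ S hS => ?_⟩
  obtain ⟨hD, hkl⟩ := hN n hn
  have hkl := hkl.trans hak
  simp only [max_le_iff] at hkl
  obtain ⟨hk1, hkK, hkr⟩ := hkl
  have hk0 : 0 < k := by exact_mod_cast (by linarith : (0 : ℝ) < k)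
  have hk : (0 : ℝ) < k := by exact_mod_cast hk0
  have hKk : K ≤ S.card := by rw [hS]; exact_mod_cast hkK
  have hm1 : 1 ≤ m := by omega
  have hmR : (0 : ℝ) < m := by exact_mod_cast hm1
  have hkn : k ≤ n := by rw [← hS]; simpa using S.card_le_univ
  have hn0 : (0 : ℝ) < n := by exact_mod_cast hk0.trans_le hkn
  set s := √(n : ℝ) / k with hs
  have hsv : √((n : ℝ) / k ^ 2) = s := by
    rw [Real.sqrt_div (Nat.cast_nonneg n), Real.sqrt_sq hk.le]
  have hs0 : 0 ≤ s := by positivity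
  have hs1 : s ≤ 1 / a := sqrt_div_le hk0 ha hak
  rw [foldedMean_eq_meanAbs 0 (by positivity), foldedMean_eq_meanAbs x (by positivity), hsv]
  set T := (1 - t) * meanAbs 0 s + t * meanAbs x s with hT
  have hg := hgap s hs0 hs1
  have hT0 : meanAbs 0 s + 5 * r ≤ T := by
    have := mul_le_mul_of_nonneg_left hg ht0.le
    rw [hT]; linarith
  have hTx : T ≤ meanAbs x s - 5 * r := by
    have := mul_le_mul_of_nonneg_left hg (by linarith : 0 ≤ 1 - t)
    rw [hT]; linarith
  have hsD : s * absMomentDist n ≤ r := by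
    calc s * absMomentDist n ≤ s * (a * r) := by gcongr
      _ ≤ 1 / a * (a * r) := by gcongr
      _ = r := by field_simp
  have hs2 : s ^ 2 ≤ (1 / a) ^ 2 := by gcongr
  have hfin : (2 + 2 * (1 / a) ^ 2) / (m * r ^ 2) ≤ δ / 2 := by
    have h1 : (M : ℝ) ≤ m := by exact_mod_cast (by omega : M ≤ m)
    have h2 := hM.trans h1
    rw [div_le_iff₀ (by positivity)] at h2 ⊢
    linarith
  have hnull : (nullSampleLaw n m μ).real {X | T ≤ globalStat k X} ≤ δ / 2 := by
    have hE := abs_integral_nullLaw_div_sub_meanAbs_le (n := n) hk0 hsymm 0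
    simp only [zero_add] at hE
    have hE' : ∫ σ, globalTerm k σ ∂(nullLaw n μ) - meanAbs 0 s ≤ s * absMomentDist n :=
      (abs_le.1 hE).2
    have hV : ∫ σ, globalTerm k σ ^ 2 ∂(nullLaw n μ) ≤ 2 + 2 * (1 / a) ^ 2 := by
      rw [integral_nullLaw_globalTerm_sq hsymm]
      nlinarith [sq_nonneg (1 / a)]
    refine (measureReal_mono (fun X hX => ?_)
      (by unfold nullSampleLaw; exact measure_ne_top _ _)).trans
      ((real_abs_sampleAvg_sub_le hm1 (nullLaw n μ) (globalTerm k) hr0 hV).trans hfin)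
    have h1 : T ≤ sampleAvg (globalTerm k) X := hX
    change r ≤ |sampleAvg (globalTerm k) X - ∫ σ, globalTerm k σ ∂(nullLaw n μ)|
    refine le_trans ?_ (le_abs_self _)
    linarith
  have halt : (cliqueSampleLaw m μ θ S).real {X | globalStat k X < T} ≤ δ / 2 := by
    have hE := abs_integral_cliqueLaw_globalTerm_sub_le (θ := θ) hsymm S (by omega)
    rw [hS, ← hs] at hE
    have hE' := (abs_le.1 hE).1
    have hL := integral_meanAbs_magnetization_ge (μ := μ) (θ := θ) S (s := s) hx0 hr0.le hrx.le
    have hP : x * (cliqueLaw μ θ S).real {σ | |magnetization S σ| ≤ x - r} ≤ r := by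
      have := mul_le_mul_of_nonneg_left (hK n S hKk) hx0.le
      rwa [mul_div_cancel₀ _ hx0.ne'] at this
    have hkk : 1 / √(k : ℝ) ≤ r := by
      rw [div_le_iff₀ (Real.sqrt_pos.2 hk), ← div_le_iff₀' hr0]
      refine Real.le_sqrt_of_sq_le ?_
      rw [div_pow, one_pow]; exact hkr
    have hV : ∫ σ, globalTerm k σ ^ 2 ∂(cliqueLaw μ θ S) ≤ 2 + 2 * (1 / a) ^ 2 := by
      have := integral_cliqueLaw_globalTerm_sq_le (θ := θ) hsymm S
      rw [hS, ← hs] at this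
      linarith
    refine (measureReal_mono (fun X hX => ?_)
      (by unfold cliqueSampleLaw; exact measure_ne_top _ _)).trans
      ((real_abs_sampleAvg_sub_le hm1 (cliqueLaw μ θ S) (globalTerm k) hr0 hV).trans hfin)
    have h1 : sampleAvg (globalTerm k) X < T := hX
    change r ≤ |sampleAvg (globalTerm k) X - ∫ σ, globalTerm k σ ∂(cliqueLaw μ θ S)|
    refine le_trans ?_ (neg_le_abs _)
    linarith
  unfold totalError
  linarith

/-! ### Folded normal limits -/

theorem tendstoInDistribution_gaussian_of_charFun {Ω : ℕ → Type*} [∀ j, MeasurableSpace (Ω j)]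
    {P : ∀ j, Measure (Ω j)} [∀ j, IsProbabilityMeasure (P j)] {Y : ∀ j, Ω j → ℝ}
    (hY : ∀ j, Measurable (Y j)) (x : ℝ) (v : ℝ≥0)
    (h : ∀ t : ℝ, Tendsto (fun j => ∫ ω, Complex.exp ((t * Y j ω : ℝ) * Complex.I) ∂(P j)) atTop
      (𝓝 (Complex.exp ((t * x : ℝ) * Complex.I) * (Real.exp (-(v * t ^ 2 / 2)) : ℝ)))) :
    TendstoInDistribution Y atTop (fun z : ℝ => z) P (gaussianReal x v) where
  forall_aemeasurable j := (hY j).aemeasurable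
  tendsto := by
    refine ProbabilityMeasure.tendsto_iff_tendsto_charFun.2 fun t => ?_
    simp only [ProbabilityMeasure.coe_mk, Measure.map_id']
    rw [charFun_gaussianReal]
    convert! h t using 1
    · funext j
      rw [charFun_apply_real, integral_map (hY j).aemeasurable
        (by fun_prop : Measurable _).aestronglyMeasurable]
      simp
    · rw [Complex.ofReal_exp, ← Complex.exp_add]
      congr 2
      push_cast
      ring

theorem tendsto_cos_pow {k N : ℕ → ℕ} {v : ℝ}
    (hk : Tendsto (fun j => (k j : ℝ)) atTop atTop)
    (hN : Tendsto (fun j => (N j : ℝ) / (k j : ℝ) ^ 2) atTop (𝓝 v)) (t : ℝ) :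
    Tendsto (fun j => Real.cos (t / k j) ^ N j) atTop (𝓝 (Real.exp (-(v * t ^ 2 / 2)))) := by
  have h0 : Tendsto (fun j => t / (k j : ℝ)) atTop (𝓝 0) := tendsto_const_nhds.div_atTop hk
  have h1 : Tendsto (fun j => Real.exp (-(N j * (t / k j) ^ 2 / 2))) atTop
      (𝓝 (Real.exp (-(v * t ^ 2 / 2)))) := by
    refine (Real.continuous_exp.tendsto _).comp (((hN.mul_const (t ^ 2)).div_const 2).neg.congr
      fun j => ?_)
    rw [div_pow]; ring
  have h2 : Tendsto (fun j => (N j : ℝ) * (t / k j) ^ 4) atTop (𝓝 0) := by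
    have := (hN.mul_const (t ^ 2)).mul (h0.pow 2)
    simp only [ne_eq, OfNat.ofNat_ne_zero, not_false_eq_true, zero_pow, mul_zero] at this
    refine this.congr fun j => ?_
    simp only [div_pow]; ring
  have h3 : Tendsto (fun j => Real.cos (t / k j) ^ N j - Real.exp (-(N j * (t / k j) ^ 2 / 2)))
      atTop (𝓝 0) := by
    refine squeeze_zero_norm' ?_ h2
    have : ∀ᶠ j in atTop, |t / (k j : ℝ)| < 1 := by
      have := h0.abs
      rw [abs_zero] at this
      exact this.eventually (gt_mem_nhds one_pos)
    filter_upwards [this] with j hj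
    exact abs_cos_pow_sub_exp_le hj.le (N j)
  simpa using h3.add h1

theorem tendsto_natCast_of_div_sq {n k : ℕ → ℕ} {v : ℝ} (hv : 0 < v)
    (hn : Tendsto n atTop atTop)
    (h : Tendsto (fun j => (n j : ℝ) / (k j : ℝ) ^ 2) atTop (𝓝 v)) :
    Tendsto (fun j => (k j : ℝ)) atTop atTop := by
  have hnR : Tendsto (fun j => (n j : ℝ)) atTop atTop := tendsto_natCast_atTop_atTop.comp hn
  have h1 : Tendsto (fun j => √((n j : ℝ) / (2 * v))) atTop atTop :=
    Real.tendsto_sqrt_atTop.comp (hnR.atTop_div_const (by positivity))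
  refine tendsto_atTop_mono' _ ?_ h1
  filter_upwards [h.eventually (gt_mem_nhds (by linarith : v < 2 * v)),
    h.eventually (lt_mem_nhds hv)] with j hj hj0
  -- For `k j = 0` the quotient takes the default value `0`, which is excluded by the positive
  -- limit.
  have hk : (0 : ℝ) < (k j : ℝ) ^ 2 := by
    rcases eq_or_ne (k j : ℝ) 0 with h0 | h0
    · rw [h0] at hj0; simp at hj0
    · positivity
  rw [div_lt_iff₀ hk] at hj
  refine Real.sqrt_le_iff.2 ⟨Nat.cast_nonneg _, ?_⟩
  rw [div_le_iff₀ (by positivity)]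
  linarith

theorem tendsto_sqrt_div {n k : ℕ → ℕ} {v : ℝ}
    (h : Tendsto (fun j => (n j : ℝ) / (k j : ℝ) ^ 2) atTop (𝓝 v)) :
    Tendsto (fun j => √(n j : ℝ) / k j) atTop (𝓝 √v) := by
  refine ((Real.continuous_sqrt.tendsto v).comp h).congr fun j => ?_
  simp only [Function.comp_apply]
  rw [Real.sqrt_div (Nat.cast_nonneg _), Real.sqrt_sq (Nat.cast_nonneg _)]

theorem tendsto_meanAbs {x : ℝ} {s : ℕ → ℝ} {s₀ : ℝ} (hs : Tendsto s atTop (𝓝 s₀)) :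
    Tendsto (fun j => meanAbs x (s j)) atTop (𝓝 (meanAbs x s₀)) := by
  rw [tendsto_iff_norm_sub_tendsto_zero] at hs ⊢
  refine squeeze_zero (fun j => norm_nonneg _) (fun j => ?_) hs
  have := abs_meanAbs_sub_le x x (s j) s₀
  simpa using this

theorem globalTerm_null_limits (hsymm : μ.map (fun h => -h) = μ) (n k : ℕ → ℕ) (v : ℝ≥0)
    (hv : 0 < v) (hn : Tendsto n atTop atTop)
    (h : Tendsto (fun j => (n j : ℝ) / (k j : ℝ) ^ 2) atTop (𝓝 (v : ℝ))) :
    TendstoInDistribution (fun j => globalTerm (n := n j) (k j)) atTop (fun z : ℝ => |z|)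
        (fun j => nullLaw (n j) μ) (gaussianReal 0 v) ∧
      Tendsto (fun j => ∫ σ, globalTerm (k j) σ ∂(nullLaw (n j) μ)) atTop
        (𝓝 (foldedMean 0 v)) := by
  have hv' : (0 : ℝ) < v := hv
  have hk := tendsto_natCast_of_div_sq hv' hn h
  constructor
  · have hd := tendstoInDistribution_gaussian_of_charFun (P := fun j => nullLaw (n j) μ)
      (Y := fun j σ => (∑ i, spin (σ i)) / (k j : ℝ)) (fun j => Measurable.of_discrete) 0 v
      (fun t => ?_)
    · exact hd.continuous_comp continuous_abs
    · have h1 : ∀ j, ∫ σ : Config (n j), Complex.exp ((t * ((∑ i, spin (σ i)) / (k j : ℝ)) : ℝ)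
          * Complex.I) ∂(nullLaw (n j) μ) = ((Real.cos (t / k j) ^ n j : ℝ) : ℂ) := fun j => by
        have := integral_nullLaw_cexp μ hsymm (Finset.univ : Finset (Fin (n j))) (t / k j)
        rw [Finset.card_univ, Fintype.card_fin] at this
        rw [← this]
        congr 1
        funext σ
        rw [div_mul_eq_mul_div, mul_div_assoc]
      simp_rw [h1]
      simpa [Function.comp_def] using
        (Complex.continuous_ofReal.tendsto _).comp (tendsto_cos_pow hk h t)
  · rw [foldedMean_eq_meanAbs 0 hv']
    have hs := tendsto_sqrt_div h
    have hb : Tendsto (fun j => √(n j : ℝ) / k j * absMomentDist (n j)) atTop (𝓝 0) := by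
      simpa using hs.mul (tendsto_absMomentDist.comp hn)
    have hd : Tendsto (fun j => ∫ σ, globalTerm (k j) σ ∂(nullLaw (n j) μ)
        - meanAbs 0 (√(n j : ℝ) / k j)) atTop (𝓝 0) := by
      refine squeeze_zero_norm' ?_ hb
      filter_upwards [hk.eventually_gt_atTop 0] with j hj
      have := abs_integral_nullLaw_div_sub_meanAbs_le (n := n j) (k := k j)
        (by exact_mod_cast hj) hsymm 0
      simpa [globalTerm] using this
    simpa using hd.add (tendsto_meanAbs (x := 0) hs)

/-- Where `m_S` is negative, reversing all signs leaves the absolute value unchanged, and the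
off-clique sum is symmetric given the clique. The replacement matters because concentration is
available for `|m_S|`, without identifying the sign of `m_S`. -/
theorem integral_cliqueLaw_comp_globalTerm (hsymm : μ.map (fun h => -h) = μ) {n : ℕ}
    (S : Finset (Fin n)) (g : ℝ → ℝ) :
    ∫ σ, g (globalTerm S.card σ) ∂(cliqueLaw μ θ S)
      = ∫ σ, g |(|magnetization S σ| + (∑ i ∈ Sᶜ, spin (σ i)) / S.card)| ∂(cliqueLaw μ θ S) := by
  simp_rw [globalTerm_eq_abs_add S]
  rw [integral_cliqueLaw_resample μ hsymm θ S (fun m w => g |m + w / S.card|),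
    integral_cliqueLaw_resample μ hsymm θ S (fun m w => g |(|m| + w / S.card)|)]
  congr 1
  funext σ
  rcases abs_choice (magnetization S σ) with h | h <;> rw [h]
  rw [← integral_nullLaw_neg_sum μ hsymm Sᶜ (fun w => g |(-magnetization S σ + w / S.card)|)]
  congr 1
  funext ε
  rw [← abs_neg]
  congr 2
  ring

theorem map_globalTerm_cliqueLaw (hsymm : μ.map (fun h => -h) = μ) {n : ℕ} (S : Finset (Fin n)) :
    (cliqueLaw μ θ S).map (globalTerm S.card) = (cliqueLaw μ θ S).map
      fun σ => |(|magnetization S σ| + (∑ i ∈ Sᶜ, spin (σ i)) / S.card)| := by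
  ext B hB
  rw [Measure.map_apply .of_discrete hB, Measure.map_apply .of_discrete hB,
    ← measureReal_eq_measureReal_iff, ← integral_indicator_one (Set.toFinite _).measurableSet,
    ← integral_indicator_one (Set.toFinite _).measurableSet]
  exact integral_cliqueLaw_comp_globalTerm hsymm S (B.indicator 1)

theorem integral_cliqueLaw_abs_sub_le {n : ℕ} (S : Finset (Fin n)) {x ε : ℝ} (hx0 : 0 ≤ x)
    (hx1 : x ≤ 1) (hε : 0 ≤ ε) :
    ∫ σ, |(|magnetization S σ| - x)| ∂(cliqueLaw μ θ S)
      ≤ ε + (cliqueLaw μ θ S).real {σ | ε ≤ |(|magnetization S σ| - x)|} := by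
  let B : Set (Config n) := {σ | ε ≤ |(|magnetization S σ| - x)|}
  have hint : ∫ σ, (ε + B.indicator 1 σ) ∂(cliqueLaw μ θ S)
      = ε + (cliqueLaw μ θ S).real B := by
    rw [integral_add .of_finite .of_finite,
      integral_indicator_one (Set.toFinite _).measurableSet]
    simp
  rw [← hint]
  refine integral_mono .of_finite .of_finite fun σ => ?_
  by_cases hσ : ε ≤ |(|magnetization S σ| - x)|
  · have h1 : B.indicator (1 : Config n → ℝ) σ = 1 := Set.indicator_of_mem (s := B) hσ _
    simp only [h1]
    have h2 := abs_magnetization_le S σ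
    have h3 := abs_nonneg (magnetization S σ)
    have : |(|magnetization S σ| - x)| ≤ 1 := abs_le.2 ⟨by linarith, by linarith⟩
    linarith
  · have h1 : B.indicator (1 : Config n → ℝ) σ = 0 := Set.indicator_of_notMem (s := B) hσ _
    simp only [h1]
    linarith [not_le.1 hσ]

theorem tendsto_integral_abs_magnetization_sub (hsymm : μ.map (fun h => -h) = μ) (hθ : 0 < θ)
    {x : ℝ} (hx : x ∈ positiveSolutions μ θ)
    (hbelow : ∀ y, 0 < y → y < x → y < meanTanh μ θ y)
    (huniq : ∀ y ∈ positiveSolutions μ θ, y = x) {n : ℕ → ℕ} (S : ∀ j, Finset (Fin (n j)))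
    (hS : Tendsto (fun j => ((S j).card : ℝ)) atTop atTop) :
    Tendsto (fun j => ∫ σ, |(|magnetization (S j) σ| - x)| ∂(cliqueLaw μ θ (S j))) atTop
      (𝓝 0) := by
  rw [Metric.tendsto_nhds]
  intro ε hε
  obtain ⟨K, hK⟩ := cliqueLaw_abs_magnetization_sub_small hsymm hθ hx hbelow huniq
    (by positivity : 0 < ε / 4) (by positivity : 0 < ε / 4)
  filter_upwards [hS.eventually_ge_atTop K] with j hj
  have h1 := integral_cliqueLaw_abs_sub_le (μ := μ) (θ := θ) (S j) hx.1.le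
    (positiveSolutions_le_one hx) (by positivity : 0 ≤ ε / 4)
  have h2 := hK _ (S j) (by exact_mod_cast hj)
  rw [Real.dist_eq, sub_zero, abs_of_nonneg (integral_nonneg fun σ => abs_nonneg _)]
  linarith

theorem globalTerm_clique_limits (hsymm : μ.map (fun h => -h) = μ) (hθ : 0 < θ)
    {x : ℝ} (hx : x ∈ positiveSolutions μ θ)
    (hbelow : ∀ y, 0 < y → y < x → y < meanTanh μ θ y)
    (huniq : ∀ y ∈ positiveSolutions μ θ, y = x) (n k : ℕ → ℕ) (S : ∀ j, Finset (Fin (n j)))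
    (v : ℝ≥0) (hSk : ∀ j, (S j).card = k j) (hv : 0 < v) (hn : Tendsto n atTop atTop)
    (h : Tendsto (fun j => (n j : ℝ) / (k j : ℝ) ^ 2) atTop (𝓝 (v : ℝ))) :
    TendstoInDistribution (fun j => globalTerm (n := n j) (k j)) atTop (fun z : ℝ => |z|)
        (fun j => cliqueLaw μ θ (S j)) (gaussianReal x v) ∧
      Tendsto (fun j => ∫ σ, globalTerm (k j) σ ∂(cliqueLaw μ θ (S j))) atTop
        (𝓝 (foldedMean x v)) := by
  obtain rfl : k = fun j => (S j).card := funext fun j => (hSk j).symm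
  have hv' : (0 : ℝ) < v := hv
  have hk := tendsto_natCast_of_div_sq hv' hn h
  have hm := tendsto_integral_abs_magnetization_sub hsymm hθ hx hbelow huniq S hk
  constructor
  · have hN : Tendsto (fun j => (((S j)ᶜ.card : ℕ) : ℝ) / ((S j).card : ℝ) ^ 2) atTop
        (𝓝 (v : ℝ)) := by
      have h1 : Tendsto (fun j => 1 / ((S j).card : ℝ)) atTop (𝓝 0) :=
        tendsto_const_nhds.div_atTop hk
      have h2 := h.sub h1
      rw [sub_zero] at h2
      refine h2.congr' ?_
      filter_upwards [hk.eventually_gt_atTop 0] with j hj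
      rw [Finset.card_compl, Fintype.card_fin, Nat.cast_sub (by simpa using (S j).card_le_univ)]
      field_simp
    have hcf : ∀ t : ℝ, Tendsto (fun j => ∫ σ, Complex.exp ((t * (|magnetization (S j) σ|
        + (∑ i ∈ (S j)ᶜ, spin (σ i)) / ((S j).card : ℝ)) : ℝ) * Complex.I)
          ∂(cliqueLaw μ θ (S j))) atTop
        (𝓝 (Complex.exp ((t * x : ℝ) * Complex.I) * (Real.exp (-(v * t ^ 2 / 2)) : ℝ))) := by
      intro t
      have h1 : ∀ j, ∫ σ, Complex.exp ((t * (|magnetization (S j) σ|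
          + (∑ i ∈ (S j)ᶜ, spin (σ i)) / ((S j).card : ℝ)) : ℝ) * Complex.I)
            ∂(cliqueLaw μ θ (S j))
          = (∫ σ, Complex.exp ((t * |magnetization (S j) σ| : ℝ) * Complex.I)
            ∂(cliqueLaw μ θ (S j))) * (Real.cos (t / (S j).card) ^ (S j)ᶜ.card : ℝ) := fun j => by
        rw [integral_cliqueLaw_resample μ hsymm θ (S j)
          (fun m w => Complex.exp ((t * (|m| + w / ((S j).card : ℝ)) : ℝ) * Complex.I)),
          ← integral_mul_const]
        congr 1
        funext σ
        rw [← integral_nullLaw_cexp μ hsymm (S j)ᶜ, ← integral_const_mul]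
        congr 1
        funext ε
        rw [← Complex.exp_add]
        congr 1
        push_cast
        ring
      simp_rw [h1]
      refine Tendsto.mul ?_ ((Complex.continuous_ofReal.tendsto _).comp (tendsto_cos_pow hk hN t))
      rw [tendsto_iff_norm_sub_tendsto_zero]
      -- The map `a ↦ exp (i t a)` is `|t|`-Lipschitz, so convergence of `|m_S|` to `x` in mean
      -- gives convergence of its characteristic function.
      have h2 := hm.const_mul |t|
      rw [mul_zero] at h2
      refine squeeze_zero (fun j => norm_nonneg _) (fun j => ?_) h2
      have h3 : ∫ σ, Complex.exp ((t * |magnetization (S j) σ| : ℝ) * Complex.I)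
            ∂(cliqueLaw μ θ (S j)) - Complex.exp ((t * x : ℝ) * Complex.I)
          = ∫ σ, (Complex.exp ((t * |magnetization (S j) σ| : ℝ) * Complex.I)
            - Complex.exp ((t * x : ℝ) * Complex.I)) ∂(cliqueLaw μ θ (S j)) := by
        rw [integral_sub .of_finite .of_finite]
        simp
      rw [h3, ← integral_const_mul]
      refine (norm_integral_le_integral_norm _).trans
        (integral_mono .of_finite .of_finite fun σ => ?_)
      have h4 : Complex.exp ((t * |magnetization (S j) σ| : ℝ) * Complex.I)
            - Complex.exp ((t * x : ℝ) * Complex.I)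
          = Complex.exp ((t * x : ℝ) * Complex.I)
            * (Complex.exp (Complex.I * ((t * |magnetization (S j) σ| - t * x : ℝ))) - 1) := by
        rw [mul_sub, ← Complex.exp_add]
        congr 2
        · push_cast; ring
        · ring
      simp only
      rw [h4, norm_mul, Complex.norm_exp_ofReal_mul_I, one_mul, ← abs_mul, mul_sub]
      exact Real.norm_exp_I_mul_ofReal_sub_one_le
    have hd := (tendstoInDistribution_gaussian_of_charFun (P := fun j => cliqueLaw μ θ (S j))
      (Y := fun j σ => |magnetization (S j) σ| + (∑ i ∈ (S j)ᶜ, spin (σ i)) / ((S j).card : ℝ))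
      (fun j => Measurable.of_discrete) x v hcf).continuous_comp continuous_abs
    refine ⟨fun j => Measurable.of_discrete.aemeasurable, by fun_prop, ?_⟩
    refine hd.tendsto.congr fun j => Subtype.ext ?_
    exact (map_globalTerm_cliqueLaw hsymm (S j)).symm
  · rw [foldedMean_eq_meanAbs x hv']
    have hs := tendsto_sqrt_div h
    -- The first two terms bound the Gaussian approximation of the noise; the third bounds the
    -- replacement of `m_S` by `x`, since `meanAbs` is even and 1-Lipschitz in its first argument.
    have hb : Tendsto (fun j => √(n j : ℝ) / (S j).card * absMomentDist (n j)
        + 1 / √((S j).card : ℝ) + ∫ σ, |(|magnetization (S j) σ| - x)| ∂(cliqueLaw μ θ (S j)))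
        atTop (𝓝 0) := by
      have h1 : Tendsto (fun j => 1 / √((S j).card : ℝ)) atTop (𝓝 0) :=
        tendsto_const_nhds.div_atTop (Real.tendsto_sqrt_atTop.comp hk)
      simpa using ((hs.mul (tendsto_absMomentDist.comp hn)).add h1).add hm
    have hd : Tendsto (fun j => ∫ σ, globalTerm (S j).card σ ∂(cliqueLaw μ θ (S j))
        - meanAbs x (√(n j : ℝ) / (S j).card)) atTop (𝓝 0) := by
      refine squeeze_zero_norm' ?_ hb
      filter_upwards [hk.eventually_gt_atTop 0] with j hj
      have h1 := abs_integral_cliqueLaw_globalTerm_sub_le (θ := θ) hsymm (S j)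
        (by exact_mod_cast hj)
      have h2 : |∫ σ, meanAbs (magnetization (S j) σ) (√(n j : ℝ) / (S j).card)
            ∂(cliqueLaw μ θ (S j)) - meanAbs x (√(n j : ℝ) / (S j).card)|
          ≤ ∫ σ, |(|magnetization (S j) σ| - x)| ∂(cliqueLaw μ θ (S j)) := by
        have h3 : meanAbs x (√(n j : ℝ) / (S j).card)
            = ∫ σ, meanAbs x (√(n j : ℝ) / (S j).card) ∂(cliqueLaw μ θ (S j)) := by simp
        rw [h3, ← integral_sub .of_finite .of_finite]
        refine abs_integral_le_integral_abs.trans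
          (integral_mono .of_finite .of_finite fun σ => ?_)
        have h4 := abs_meanAbs_sub_le |magnetization (S j) σ| x (√(n j : ℝ) / (S j).card)
          (√(n j : ℝ) / (S j).card)
        rw [meanAbs_abs, sub_self, abs_zero, add_zero] at h4
        exact h4
      rw [Real.norm_eq_abs]
      refine (abs_sub_le _ (∫ σ, meanAbs (magnetization (S j) σ) (√(n j : ℝ) / (S j).card)
            ∂(cliqueLaw μ θ (S j))) _).trans ?_
      linarith
    simpa using hd.add (tendsto_meanAbs (x := x) hs)

end

end PlantedRFCW

theorem mainTheorem7 (μ : Measure ℝ) [IsProbabilityMeasure μ]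
    (hsymm : μ.map (fun h => -h) = μ) (θ : ℝ) (hlow : 1 / meanSechSq μ < θ) :
    ∃ x : ℝ, IsLeast (positiveSolutions μ θ) x ∧
      -- scan test: `m ≥ C log n` samples suffice, uniformly over all sizes `k → ∞`
      (∀ τ ∈ Set.Ioo 0 x, ∃ C > 0, ∀ δ > 0, ∃ K : ℕ, ∀ n m k : ℕ, K ≤ k →
        C * Real.log n ≤ m → ∀ S : Finset (Fin n), S.card = k →
          totalError (m := m) μ θ (scanStat k) τ S ≤ δ) ∧
      -- global test, `k ≍ √n`: a bounded number of samples suffices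
      (∀ a b : ℝ, 0 < a → a ≤ b → ∀ t ∈ Set.Ioo (0 : ℝ) 1, ∀ δ > 0, ∃ M N : ℕ,
        ∀ n m k : ℕ, N ≤ n → M ≤ m → a * √n ≤ k → k ≤ b * √n →
          ∀ S : Finset (Fin n), S.card = k →
            totalError (m := m) μ θ (globalStat k)
              ((1 - t) * foldedMean 0 ((n : ℝ) / k ^ 2) + t * foldedMean x ((n : ℝ) / k ^ 2)) S
                ≤ δ) ∧
      -- folded normal limit and convergence of means under the null, `n / k² → v`
      (∀ (n k : ℕ → ℕ) (v : ℝ≥0), 0 < v → Tendsto n atTop atTop →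
        Tendsto (fun j => (n j : ℝ) / (k j : ℝ) ^ 2) atTop (𝓝 (v : ℝ)) →
          TendstoInDistribution (fun j => globalTerm (n := n j) (k j)) atTop (fun z : ℝ => |z|)
            (fun j => nullLaw (n j) μ) (gaussianReal 0 v) ∧
          Tendsto (fun j => ∫ σ, globalTerm (k j) σ ∂(nullLaw (n j) μ)) atTop
            (𝓝 (foldedMean 0 v))) ∧
      -- folded normal limit and convergence of means under the alternative, `n / k² → v`
      ((∀ y ∈ positiveSolutions μ θ, y = x) →
        ∀ (n k : ℕ → ℕ) (S : ∀ j, Finset (Fin (n j))) (v : ℝ≥0), (∀ j, (S j).card = k j) → 0 < v →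
          Tendsto n atTop atTop →
          Tendsto (fun j => (n j : ℝ) / (k j : ℝ) ^ 2) atTop (𝓝 (v : ℝ)) →
            TendstoInDistribution (fun j => globalTerm (n := n j) (k j)) atTop (fun z : ℝ => |z|)
              (fun j => cliqueLaw μ θ (S j)) (gaussianReal x v) ∧
            Tendsto (fun j => ∫ σ, globalTerm (k j) σ ∂(cliqueLaw μ θ (S j))) atTop
              (𝓝 (foldedMean x v))) ∧
      -- global test, `k = ω(√n)`: one sample (or any larger number) suffices
      (∀ τ ∈ Set.Ioo 0 x, ∀ δ > 0, ∃ A : ℝ, ∀ n m k : ℕ, 0 < k → 1 ≤ m → A * √n ≤ k →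
        ∀ S : Finset (Fin n), S.card = k →
          totalError (m := m) μ θ (globalStat k) τ S ≤ δ) ∧
      -- limits in probability of the one-sample statistic, `k = ω(√n)`
      (∀ ε > 0, ∀ δ > 0, ∃ A : ℝ, ∀ n k : ℕ, 0 < k → A * √n ≤ k →
        (nullLaw n μ).real {σ | ε ≤ globalTerm k σ} ≤ δ) ∧
      ((∀ y ∈ positiveSolutions μ θ, y = x) →
        ∀ ε > 0, ∀ δ > 0, ∃ A : ℝ, ∀ n k : ℕ, 0 < k → A * √n ≤ k →
          ∀ S : Finset (Fin n), S.card = k →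
            (cliqueLaw μ θ S).real {σ | ε ≤ |globalTerm k σ - x|} ≤ δ) := by
  have hθ : 0 < θ := theta_pos hlow
  obtain ⟨x, hleast, hbelow⟩ := exists_isLeast_positiveSolutions hsymm hlow
  have hx := hleast.1
  exact ⟨x, hleast, scanTest_consistent hsymm hθ hx hbelow,
    globalTest_critical_consistent hsymm hθ hx hbelow,
    globalTerm_null_limits hsymm,
    fun huniq n k S v hSk hv hn h =>
      globalTerm_clique_limits hsymm hθ hx hbelow huniq n k S v hSk hv hn h,
    globalTest_large_consistent hsymm hθ hx hbelow,
    globalTerm_null_small hsymm,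
    fun huniq => globalTerm_clique_small hsymm hθ hx hbelow huniq⟩
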